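/- A \emph{digit space} $(X,D)$ is a non-empty compact metric space $(X,\rho)$ with a finite set $D$ of contractions $d : X^{\mathrm{ar}(d)} \to X$ (``digits'') of positive finite arity, powers of $X$ carrying the maximum metric, such that $X = \bigcup_{d \in D} \mathrm{range}(d)$. It is \emph{well-covering} if every $x \in X$ lies in the interior of $\mathrm{range}(d)$ for some $d\in D$. Let $Q = \{u_0, u_1, \dots\}$ be a countable dense subset of $X$; procedures below operate on indices of elements of $Q$ and on codes of rational numbers. $(X,D,Q)$ is a \emph{computable digit space} if the relations $\rho(u,v) < r$ and $\rho(u,v) > r$ on $Q \times Q \times \mathbb{Q}$ are recursively enumerable and every digit $d$ has a computable modulus of uniform continuity $\zeta : \mathbb{Q}_+ \to \mathbb{Q}_+$ and a procedure which, given $\vec u \in Q^{\mathrm{ar}(d)}$ and $n$, computes $v \in Q$ with $\rho(d(\vec u), v) < 2^{-n}$. It is \emph{decidable} if, for $u \in Q$, $\theta \in \mathbb{Q}_+$ and $d \in D$, it is decidable whether the open ball $B_\rho(u,\theta)$ is contained in $\mathrm{range}(d)$. It has \emph{approximable choice} if for every $d \in D$ there is an effective procedure $(\theta,u) \mapsto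 v^\theta_u \in Q^{\mathrm{ar}(d)}$, defined for $\theta \in \mathbb{Q}_+$ and $u \in \mathrm{int}(\mathrm{range}(d)) \cap Q$, such that for all $\theta, \tilde\theta \in \mathbb{Q}_+$ and all such $u$: (1) $\rho(v^\theta_u, v^{\tilde\theta}_u) < \max\{\theta, \tilde\theta\}$; (2) one can compute from $\theta$ some $\theta' \in \mathbb{Q}_+$ such that for all $u, u' \in \mathrm{int}(\mathrm{range}(d)) \cap Q$, $\rho(u,u') < \theta'$ implies $\rho(v^\theta_u, v^\theta_{u'}) < \theta$; (3) there is $\vec y$ with $d(\vec y) = u$ and $\rho(\vec y, v^\theta_u) < \theta$. Let $(X,D,Q)$ be a well-covering and decidable computable digit space with approximable choice, all of whose digits have arity $1$. Let $\mathcal{K}(X)$ be the space of non-empty compact subsets of $X$ with the Hausdorff metric $\rho_{\mathrm H}$, let $\mathcal{Q}_{\mathcal{K}(X)}$ be the set of non-empty finite subsets of $Q$, and let $\mathcal{K}(D)$ be the set of all maps $[d_1,\dots,d_r] : \mathcal{K}(X)^r \to \mathcal{K}(X)$, $[d_1,\dots,d_r](K_1,\dots,K_r) = \bigcup_{\kappa=1}^r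 d_\kappa[K_\kappa]$, with $r > 0$ and $d_1,\dots,d_r \in D$ pairwise distinct. Put \[ \mathbb{A}_{\mathcal{K}(X)}(K) :\Leftrightarrow (\forall n \in \mathbb{N})(\exists U \in \mathcal{Q}_{\mathcal{K}(X)})\ \rho_{\mathrm H}(K,U) < 2^{-n}, \] and let $\mathbb{C}_{\mathcal{K}(X)} \subseteq \mathcal{K}(X)$ be the largest set with \[ \mathbb{C}_{\mathcal{K}(X)}(K) \Leftrightarrow (\exists [d_1,\dots,d_r] \in \mathcal{K}(D))(\exists K_1,\dots,K_r \in \mathcal{K}(X))\ K = [d_1,\dots,d_r](K_1,\dots,K_r) \wedge (\forall \kappa \le r)\ \mathbb{C}_{\mathcal{K}(X)}(K_\kappa). \] A realiser of $\mathbb{A}_{\mathcal{K}(X)}(K)$ is a sequence $(U_n)_{n\in\mathbb N}$ in $\mathcal{Q}_{\mathcal{K}(X)}$ with $\rho_{\mathrm H}(K,U_n) < 2^{-n}$ for all $n$. The relation ``the tree $T$ is a realiser of $\mathbb{C}_{\mathcal{K}(X)}(K)$'', between infinite trees whose nodes are labelled by elements $[d_1,\dots,d_r]$ of $\mathcal{K}(D)$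 (a node with that label having exactly $r$ children) and elements $K$ of $\mathcal{K}(X)$, is the largest relation such that a tree with root label $[d_1,\dots,d_r]$ and immediate subtrees $T_1,\dots,T_r$ realises $\mathbb{C}_{\mathcal{K}(X)}(K)$ if and only if there are $K_1,\dots,K_r \in \mathcal{K}(X)$ such that $K = [d_1,\dots,d_r](K_1,\dots,K_r)$ and $T_\kappa$ realises $\mathbb{C}_{\mathcal{K}(X)}(K_\kappa)$ for all $\kappa$. Then $\mathbb{A}_{\mathcal{K}(X)} = \mathbb{C}_{\mathcal{K}(X)}$, and this equality holds effectively: there is a computable operator (on infinite sequences of codes) that transforms, for every $K \in \mathcal{K}(X)$, each realiser of $\mathbb{A}_{\mathcal{K}(X)}(K)$ into a realiser of $\mathbb{C}_{\mathcal{K}(X)}(K)$, and there is a computable operator that transforms, for every $K \in \mathcal{K}(X)$, each realiser of $\mathbb{C}_{\mathcal{K}(X)}(K)$ into a realiser of $\mathbb{A}_{\mathcal{K}(X)}(K)$. -/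

import Mathlib

open TopologicalSpace

noncomputable section

namespace DigitSpace

/-! ### Codes for rational numbers -/

/-- Every rational number is `ratCode (a, b, c) = (a - b) / (c + 1)` for some naturals `a b c`. -/
def ratCode (t : ℕ × ℕ × ℕ) : ℚ := ((t.1 : ℚ) - (t.2.1 : ℚ)) / ((t.2.2 : ℚ) + 1)

/-- Every positive rational number is `posRat (a, b) = (a + 1) / (b + 1)` for some naturals. -/
def posRat (t : ℕ × ℕ) : ℚ := ((t.1 : ℚ) + 1) / ((t.2 : ℚ) + 1)

/-! ### Extended iterated function systems and digit spaces -/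

/-- A finite family, indexed by `D`, of continuous maps `X ^ (ar d) → X` of positive finite arity
`ar d`. (Non-emptiness of `X` is part of `IsDigitSpace` below.) -/
structure ExtendedIFS (X : Type*) (D : Type*) [TopologicalSpace X] where
  finite_digits : Finite D
  ar : D → ℕ
  ar_pos : ∀ d, 0 < ar d
  map : ∀ d, (Fin (ar d) → X) → X
  continuous_map : ∀ d, Continuous (map d)

/-- Infinite `D`-trees: a set of words that is closed under prefixes (those with
`(label s).isSome`), together with a labelling of it by digits, such that the children of a node
labelled `d` are exactly its extensions by one of the letters `0, …, ar d - 1`. -/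
structure DTree {D : Type*} (ar : D → ℕ) where
  label : List ℕ → Option D
  root_mem : (label []).isSome
  append_mem_iff : ∀ (s : List ℕ) (i : ℕ),
    (label (s ++ [i])).isSome ↔ ∃ d, label s = some d ∧ i < ar d

namespace DTree

variable {D : Type*} {ar : D → ℕ}

/-- The label of the root. -/
def root (T : DTree ar) : D := (T.label []).get T.root_mem

/-- The immediate subtree with number `i`. -/
def subtree (T : DTree ar) (i : Fin (ar T.root)) : DTree ar where
  label s := T.label (i.1 :: s)
  root_mem := (T.append_mem_iff [] i.1).2 ⟨T.root, by simp [root], i.2⟩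
  append_mem_iff s j := T.append_mem_iff (i.1 :: s) j

/-- The tree as a point of Baire space: its labelling function, written in the standard
numberings of words and of labels. -/
def name [Encodable D] (T : DTree ar) : ℕ → ℕ :=
  fun n => Encodable.encode (T.label (Denumerable.ofNat (List ℕ) n))

end DTree

namespace ExtendedIFS

section Topological

variable {X D : Type*} [TopologicalSpace X] (S : ExtendedIFS X D)

/-- Every point lies in the range of some digit. -/
def IsCovering : Prop := ∀ x : X, ∃ d, x ∈ Set.range (S.map d)

/-- Every point lies in the interior of the range of some digit. -/
def IsWellCovering : Prop := ∀ x : X, ∃ d, x ∈ interior (Set.range (S.map d))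

/-- The co-inductive predicate `ℂ_X`, the largest `C` with
`C x ↔ ∃ d, ∃ y₁, …, y_{ar d}, x = d (y₁, …, y_{ar d}) ∧ ∀ κ, C y_κ`. -/
def coindSet : Set X :=
  OrderHom.gfp
    { toFun := fun C : Set X =>
        {x | ∃ d, ∃ y : Fin (S.ar d) → X, x = S.map d y ∧ ∀ κ, y κ ∈ C}
      monotone' := by
        rintro C C' h x ⟨d, y, hx, hy⟩
        exact ⟨d, y, hx, fun κ => h (hy κ)⟩ }

/-- The pairs `(T, x)` such that the tree `T` realises the statement `ℂ_X x`: the largest `R` with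
`([d; T₁, …, T_{ar d}], x) ∈ R ↔ ∃ y₁, …, y_{ar d}, x = d (y₁, …, y_{ar d}) ∧ ∀ κ, (T_κ, y_κ) ∈ R`.
-/
def treeRealisers : Set (DTree S.ar × X) :=
  OrderHom.gfp
    { toFun := fun R : Set (DTree S.ar × X) =>
        {p | ∃ y : Fin (S.ar p.1.root) → X,
          p.2 = S.map p.1.root y ∧ ∀ κ, (p.1.subtree κ, y κ) ∈ R}
      monotone' := by
        rintro R R' h p ⟨y, hx, hy⟩
        exact ⟨y, hx, fun κ => h (hy κ)⟩ }

/-- `p` is (the name of) a realiser of `ℂ_X x`. -/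
def IsTreeName [Encodable D] (p : ℕ → ℕ) (x : X) : Prop :=
  ∃ T : DTree S.ar, T.name = p ∧ (T, x) ∈ S.treeRealisers

end Topological

section Metric

variable {X D I : Type*} [MetricSpace X]

/-- Digit spaces: non-empty compact covering systems of contractions, where powers of `X` carry
the maximum metric. -/
structure IsDigitSpace (S : ExtendedIFS X D) : Prop where
  nonempty : Nonempty X
  compact : CompactSpace X
  covering : S.IsCovering
  contracting : ∀ d, ∃ q : NNReal, q < 1 ∧ LipschitzWith q (S.map d)

end Metric

end ExtendedIFS

/-! ### Computability

A countable dense subset `Q` of `X` is given by a surjective numbering `u : I → Q ⊆ X`, where `I`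
is a type of finite objects. Procedures work on indices of basic elements and on codes of
rational numbers. -/

/-- `X` with the basic elements `u i` is a computable metric space. -/
structure IsComputableMetric {X I : Type*} [MetricSpace X] [Primcodable I] (u : I → X) : Prop where
  dense : DenseRange u
  re_lt : REPred fun t : (I × I) × (ℕ × ℕ × ℕ) => dist (u t.1.1) (u t.1.2) < (ratCode t.2 : ℝ)
  re_gt : REPred fun t : (I × I) × (ℕ × ℕ × ℕ) => (ratCode t.2 : ℝ) < dist (u t.1.1) (u t.1.2)

/-- A map `h : X ^ k → X` is computable: it has a computable modulus of (uniform) continuity and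
its values at basic elements can be computably approximated. -/
def IsComputableMap {X I : Type*} [MetricSpace X] [Primcodable I] (u : I → X) {k : ℕ}
    (h : (Fin k → X) → X) : Prop :=
  (∃ ζ : ℕ × ℕ → ℕ × ℕ, Computable ζ ∧
    ∀ (ε : ℕ × ℕ) (x y : Fin k → X),
      dist x y < (posRat (ζ ε) : ℝ) → dist (h x) (h y) < (posRat ε : ℝ)) ∧
  (∃ G : (Fin k → I) × ℕ → I, Computable G ∧
    ∀ (i : Fin k → I) (n : ℕ), dist (h fun κ => u (i κ)) (u (G (i, n))) < (2 : ℝ)⁻¹ ^ n)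

namespace ExtendedIFS

variable {X D I : Type*} [MetricSpace X] [Primcodable I]

/-- Computable digit spaces, with basic elements `u i`. -/
structure IsComputableDigitSpace (S : ExtendedIFS X D) (u : I → X) : Prop where
  digitSpace : S.IsDigitSpace
  metric : IsComputableMetric u
  digits : ∀ d, IsComputableMap u (S.map d)

/-- For basic `u i`, positive rational `θ` and `d ∈ D` (there are only finitely many) it can be
decided whether the open ball of radius `θ` around `u i` is contained in the range of `d`. -/
def IsDecidable (S : ExtendedIFS X D) (u : I → X) : Prop :=
  ∀ d, ComputablePred fun t : I × (ℕ × ℕ) =>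
    Metric.ball (u t.1) (posRat t.2 : ℝ) ⊆ Set.range (S.map d)

/-- For every digit `d` there is an effective procedure `v`, defined (at least) for all positive
rationals `θ` and all basic elements in the interior of the range of `d`, with values in
`Q ^ (ar d)`, satisfying the three conditions of approximable choice. -/
def HasApproximableChoice (S : ExtendedIFS X D) (u : I → X) : Prop :=
  ∀ d, ∃ v : (ℕ × ℕ) × I →. (Fin (S.ar d) → I), Partrec v ∧
    (∀ θ i, u i ∈ interior (Set.range (S.map d)) → (v (θ, i)).Dom) ∧
    (∀ θ θ' i, u i ∈ interior (Set.range (S.map d)) →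
      ∀ a ∈ v (θ, i), ∀ b ∈ v (θ', i),
        dist (fun κ => u (a κ)) (fun κ => u (b κ)) < max (posRat θ : ℝ) (posRat θ' : ℝ)) ∧
    (∃ η : ℕ × ℕ → ℕ × ℕ, Computable η ∧
      ∀ θ i j, u i ∈ interior (Set.range (S.map d)) → u j ∈ interior (Set.range (S.map d)) →
        dist (u i) (u j) < (posRat (η θ) : ℝ) →
        ∀ a ∈ v (θ, i), ∀ b ∈ v (θ, j),
          dist (fun κ => u (a κ)) (fun κ => u (b κ)) < (posRat θ : ℝ)) ∧
    (∀ θ i, u i ∈ interior (Set.range (S.map d)) →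
      ∀ a ∈ v (θ, i), ∃ y : Fin (S.ar d) → X,
        S.map d y = u i ∧ dist y (fun κ => u (a κ)) < (posRat θ : ℝ))

end ExtendedIFS

/-! ### The Cauchy representation -/

section Cauchy

variable {X I : Type*} [MetricSpace X]

/-- The predicate `𝔸_X`. -/
def cauchySet (u : I → X) : Set X := {x | ∀ n : ℕ, ∃ i, dist x (u i) < (2 : ℝ)⁻¹ ^ n}

/-- `p` is (the name of) a realiser of `𝔸_X x`: a sequence of basic elements whose `n`-th member
has distance less than `2⁻ⁿ` from `x`. -/
def IsCauchyName [Encodable I] (u : I → X) (p : ℕ → ℕ) (x : X) : Prop :=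
  ∃ w : ℕ → I, (∀ n, p n = Encodable.encode (w n)) ∧
    ∀ n : ℕ, dist x (u (w n)) < (2 : ℝ)⁻¹ ^ n

end Cauchy

/-! ### Computable operators on Baire space -/

/-- The operator on Baire space given by `φ` maps `p` to `q`: on a finite initial segment of `p`
and an argument `n`, the program `φ` either gives no answer or answers `q n`, and it does answer
once the initial segment is long enough. -/
def OperatorMaps (φ : List ℕ → ℕ → Option ℕ) (p q : ℕ → ℕ) : Prop :=
  ∀ n, (∃ k, φ ((List.range k).map p) n = some (q n)) ∧
    ∀ k a, φ ((List.range k).map p) n = some a → a = q n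

/-- One computable (partial) operator on Baire space transforms, for every `x`, all `A`-names of
`x` into `B`-names of `x`. With `A`, `B` the realisability relations of two predicates, this says
that the inclusion of the first predicate in the second is computably realised. -/
def ComputablyTranslates {Y : Type*} (A B : (ℕ → ℕ) → Y → Prop) : Prop :=
  ∃ φ : List ℕ → ℕ → Option ℕ, Computable₂ φ ∧
    ∀ p y, A p y → ∃ q, OperatorMaps φ p q ∧ B q y

/-! ### The hyperspace of non-empty compact sets -/

/-- The basic subsets: the non-empty finite sets of basic elements, numbered by the non-empty
lists of indices, given by head and tail. -/
def basicSubset {X I : Type*} [TopologicalSpace X] (u : I → X) (l : I × List I) :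
    NonemptyCompacts X where
  carrier := {x | ∃ i ∈ l.1 :: l.2, x = u i}
  isCompact' := by
    have h : {x | ∃ i ∈ l.1 :: l.2, x = u i} = u '' {i | i ∈ l.1 :: l.2} := by
      ext x
      simp only [Set.mem_ofPred_eq, Set.mem_image, eq_comm]
    rw [h]
    exact ((List.finite_toSet _).image u).isCompact
  nonempty' := ⟨u l.1, l.1, List.mem_cons_self, rfl⟩

/-- Labels of the digits `[d₁, …, d_r]` of the hyperspace: `r > 0` and the `d_κ` are pairwise
distinct digits. -/
abbrev HyperDigit (D : Type*) : Type _ := {l : List D // l ≠ [] ∧ l.Nodup}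

namespace ExtendedIFS

variable {X D : Type*} [TopologicalSpace X]

/-- The digit `d` as a self-map of `X`, for `d` of arity one. -/
def unary (S : ExtendedIFS X D) (d : D) (x : X) : X := S.map d fun _ => x

theorem continuous_unary (S : ExtendedIFS X D) (d : D) : Continuous (S.unary d) :=
  (S.continuous_map d).comp (continuous_pi fun _ => continuous_id)

/-- `[d₁, …, d_r](K₁, …, K_r) = d₁[K₁] ∪ ⋯ ∪ d_r[K_r]`. -/
def hyperMap (S : ExtendedIFS X D) (e : HyperDigit D)
    (K : Fin e.1.length → NonemptyCompacts X) : NonemptyCompacts X where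
  carrier := ⋃ κ, S.unary (e.1.get κ) '' (K κ : Set X)
  isCompact' := isCompact_iUnion fun κ => (K κ).isCompact.image (S.continuous_unary _)
  nonempty' :=
    Set.nonempty_iUnion.2 ⟨⟨0, List.length_pos_iff.2 e.2.1⟩, (K _).nonempty.image _⟩

theorem continuous_hyperMap (S : ExtendedIFS X D) (e : HyperDigit D) :
    Continuous (S.hyperMap e) := by
  rw [NonemptyCompacts.isEmbedding_toCompacts.continuous_iff]
  have h : (NonemptyCompacts.toCompacts ∘ S.hyperMap e) = fun K => Finset.univ.sup fun κ =>
      (NonemptyCompacts.map (S.unary (e.1.get κ)) (S.continuous_unary _) (K κ)).toCompacts := by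
    funext K
    apply Compacts.ext
    rw [Compacts.coe_finset_sup]
    simp [hyperMap]
  rw [h]
  refine Continuous.finset_sup_apply (s := Finset.univ)
    (f := fun κ (K : Fin e.1.length → NonemptyCompacts X) =>
      (NonemptyCompacts.map (S.unary (e.1.get κ)) (S.continuous_unary _) (K κ)).toCompacts)
    fun κ _ => ?_
  exact NonemptyCompacts.continuous_toCompacts.comp
    ((S.continuous_unary _).nonemptyCompacts_map.comp (continuous_apply κ))

/-- The system `(𝒦(X), 𝒦(D))`, for a system `(X, D)` with unary digits only. -/
def hyper (S : ExtendedIFS X D) : ExtendedIFS (NonemptyCompacts X) (HyperDigit D) where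
  finite_digits := by
    classical
    have := S.finite_digits
    have := Fintype.ofFinite D
    exact Finite.of_injective
      (fun e : HyperDigit D => (⟨e.1, e.2.2⟩ : {l : List D // l.Nodup}))
      fun a b h => Subtype.ext (congrArg (fun l : {l : List D // l.Nodup} => l.1) h)
  ar e := e.1.length
  ar_pos e := List.length_pos_iff.2 e.2.1
  map e := S.hyperMap e
  continuous_map e := S.continuous_hyperMap e

end ExtendedIFS

end DigitSpace

end

/-! Both predicates hold for every non-empty compact set. For `𝔸` this is density together with
compactness (`cauchySet_basicSubset_eq_univ`). For `ℂ`, the non-empty sets among the preimages of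
`K` under the digits are compact and their images cover `K`, so the whole hyperspace is a post-fixed
point (`coindSet_hyper_eq_univ`). The content of the theorem lies in the two operators.

From names to trees. By compactness there is a Lebesgue number `2⁻ᶜ`: every ball of that radius lies
in the range of some digit. Given a name of `K`, take the approximation with index `c + 5` and
select for each `d` the points whose `2⁻ᶜ`-ball lies in the range of `d`; this is decidable. The
digits with a selected point form the root label. Starting from the selected points, pass through
the later approximations, keeping only points close to a point kept before. The steps shrink
geometrically, so the kept points converge to a compact part of `K` and never drift far enough to
leave the interior of the range of `d`. Approximable choice therefore applies to all of them, and
along a subsequence dictated by its modulus the chosen preimages form a name of a compact set which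
`d` maps onto that part. Every point of `K` is followed by at least one digit, so the parts cover
`K`. This is `Splitter.Correct.exists_split`; iterating it gives the tree, which is a realiser by
coinduction. Each label depends on an initial segment of the name whose length is computable from
the node, so the process is a computable operator.

From trees to names. The digits have a common contraction factor `q < 1`, so compositions of `k`
digits have images of diameter at most `qᵏ · diam X`. Reading the tree to a sufficient depth and
applying each composition found there, approximately, to one fixed basic point gives a finite set
close to `K` (`compose_frontier`, `dist_levelApproximation_lt`). -/

/-! ### Computable functions on lists -/

namespace Computable

variable {α β σ : Type*} [Primcodable α] [Primcodable β] [Primcodable σ]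

/-- The fold is a recursion on the position in the list; after `n` steps it has processed `take n`.
The other list operations are reduced to this one. -/
theorem list_foldl {f : α → List β} {g : α → σ} {h : α → σ × β → σ} (hf : Computable f)
    (hg : Computable g) (hh : Computable₂ h) :
    Computable fun a => (f a).foldl (fun s b => h a (s, b)) (g a) := by
  have key : Computable fun a => Nat.rec (motive := fun _ => σ) (g a)
      (fun n s => Option.casesOn (motive := fun _ => σ) ((f a)[n]?) s fun b => h a (s, b))
      (f a).length := by
    refine nat_rec (h := fun a (p : ℕ × σ) =>
      Option.casesOn (motive := fun _ => σ) ((f a)[p.1]?) p.2 fun b => h a (p.2, b))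
      (list_length.comp hf) hg ?_
    refine option_casesOn (list_getElem?.comp (hf.comp fst) (fst.comp snd)) (snd.comp snd) ?_
    exact hh.comp (fst.comp fst) (pair (snd.comp (snd.comp fst)) snd)
  refine key.of_eq fun a => ?_
  have : ∀ n, n ≤ (f a).length → Nat.rec (motive := fun _ => σ) (g a)
      (fun n s => Option.casesOn (motive := fun _ => σ) ((f a)[n]?) s fun b => h a (s, b)) n
      = ((f a).take n).foldl (fun s b => h a (s, b)) (g a) := by
    intro n hn
    induction n with
    | zero => simp
    | succ n ih =>
      have hlt : n < (f a).length := hn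
      simp only [ih hlt.le, List.take_add_one, List.getElem?_eq_getElem hlt, List.foldl_append]
      rfl
  simpa using this _ le_rfl

theorem list_foldr {f : α → List β} {g : α → σ} {h : α → β × σ → σ} (hf : Computable f)
    (hg : Computable g) (hh : Computable₂ h) :
    Computable fun a => (f a).foldr (fun b s => h a (b, s)) (g a) :=
  (list_foldl (f := fun a => (f a).reverse) (h := fun a p => h a (p.2, p.1))
    (list_reverse.comp hf) hg (hh.comp fst (pair (snd.comp snd) (fst.comp snd)))).of_eq
    fun a => by simp

theorem list_filter {f : α → List β} {p : α → β → Bool} (hf : Computable f)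
    (hp : Computable₂ p) : Computable fun a => (f a).filter (p a) := by
  have : Computable fun a => (f a).foldr (fun b s => bif p a b then b :: s else s) [] :=
    list_foldr (h := fun a (q : β × List β) => bif p a q.1 then q.1 :: q.2 else q.2) hf (const [])
      (cond (hp.comp fst (fst.comp snd)) (list_cons.comp (fst.comp snd) (snd.comp snd))
        (snd.comp snd))
  refine this.of_eq fun a => ?_
  induction f a with
  | nil => rfl
  | cons b l ih => cases h : p a b <;> simp [h, ih]

theorem list_map {f : α → List β} {g : α → β → σ} (hf : Computable f) (hg : Computable₂ g) :
    Computable fun a => (f a).map (g a) := by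
  have : Computable fun a => (f a).foldr (fun b s => g a b :: s) [] :=
    list_foldr (h := fun a (q : β × List σ) => g a q.1 :: q.2) hf (const [])
      (list_cons.comp (hg.comp fst (fst.comp snd)) (snd.comp snd))
  refine this.of_eq fun a => ?_
  induction f a with
  | nil => rfl
  | cons b l ih => simp [ih]

theorem list_flatMap {f : α → List β} {g : α → β → List σ} (hf : Computable f)
    (hg : Computable₂ g) : Computable fun a => (f a).flatMap (g a) := by
  have : Computable fun a => (f a).foldr (fun b s => g a b ++ s) [] :=
    list_foldr (h := fun a (q : β × List σ) => g a q.1 ++ q.2) hf (const [])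
      (list_append.comp (hg.comp fst (fst.comp snd)) (snd.comp snd))
  refine this.of_eq fun a => ?_
  induction f a with
  | nil => rfl
  | cons b l ih => simp [ih]

theorem list_any {f : α → List β} {p : α → β → Bool} (hf : Computable f)
    (hp : Computable₂ p) : Computable fun a => (f a).any (p a) := by
  have : Computable fun a => (f a).foldr (fun b s => bif p a b then true else s) false :=
    list_foldr (h := fun a (q : β × Bool) => bif p a q.1 then true else q.2) hf (const false)
      (cond (hp.comp fst (fst.comp snd)) (const true) (snd.comp snd))
  refine this.of_eq fun a => ?_
  induction f a with
  | nil => rfl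
  | cons b l ih => rw [List.foldr_cons, ih]; cases h : p a b <;> simp [h]

theorem list_all {f : α → List β} {p : α → β → Bool} (hf : Computable f)
    (hp : Computable₂ p) : Computable fun a => (f a).all (p a) := by
  have : Computable fun a => (f a).foldr (fun b s => bif p a b then s else false) true :=
    list_foldr (h := fun a (q : β × Bool) => bif p a q.1 then q.2 else false) hf (const true)
      (cond (hp.comp fst (fst.comp snd)) (snd.comp snd) (const false))
  refine this.of_eq fun a => ?_
  induction f a with
  | nil => rfl
  | cons b l ih => rw [List.foldr_cons, ih]; cases h : p a b <;> simp [h]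

theorem list_getD (d : β) : Computable₂ fun (l : List β) n => l.getD n d :=
  (Primrec.list_getD d).to_comp

/-- A finite family of computable functions is computable as a function of two arguments. -/
theorem fin_family {m : ℕ} {f : Fin m → α → σ} (hf : ∀ i, Computable (f i)) :
    Computable₂ f :=
  (vector_get.comp (vector_ofFn (f := fun i (p : Fin m × α) => f i p.2)
    fun i => (hf i).comp snd) fst).of_eq fun p => by simp

theorem nat_iterate {f : α → ℕ} {g : α → σ} {h : α → σ → σ} (hf : Computable f)
    (hg : Computable g) (hh : Computable₂ h) : Computable fun a => (h a)^[f a] (g a) := by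
  have : Computable fun a => Nat.rec (motive := fun _ => σ) (g a) (fun _ s => h a s) (f a) :=
    nat_rec (h := fun a (p : ℕ × σ) => h a p.2) hf hg (hh.comp fst (snd.comp snd))
  refine this.of_eq fun a => ?_
  induction f a with
  | zero => rfl
  | succ n ih => rw [Function.iterate_succ_apply', ← ih]

theorem nat_add : Computable₂ ((· + ·) : ℕ → ℕ → ℕ) := Primrec.nat_add.to_comp

theorem nat_mul : Computable₂ ((· * ·) : ℕ → ℕ → ℕ) := Primrec.nat_mul.to_comp

theorem two_pow : Computable fun n : ℕ => 2 ^ n := by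
  have : Computable fun n : ℕ => Nat.rec (motive := fun _ => ℕ) 1 (fun _ s => s * 2) n :=
    nat_rec (h := fun _ (p : ℕ × ℕ) => p.2 * 2) Computable.id (const 1)
      (nat_mul.comp (snd.comp snd) (const 2))
  refine this.of_eq fun n => ?_
  induction n with
  | zero => rfl
  | succ n ih => rw [pow_succ, ← ih]

theorem nat_ltb : Computable₂ fun a b : ℕ => decide (a < b) := by
  have := Primrec.nat_lt.decide
  exact this.to_comp

/-- Finitely many computable sequences have a common computable monotone upper bound. -/
theorem exists_monotone_bound {m : ℕ} {f : Fin m → ℕ → ℕ} (hf : ∀ i, Computable (f i)) :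
    ∃ J : ℕ → ℕ, Computable J ∧ Monotone J ∧ ∀ i n, f i n ≤ J n := by
  have hs : Computable fun n => ((List.finRange m).map fun i => f i n).foldr (· + ·) 0 :=
    list_foldr (h := fun _ (p : ℕ × ℕ) => p.1 + p.2)
      (list_map (g := fun n i => f i n) (const (List.finRange m)) ((fin_family hf).comp snd fst))
      (const 0) (nat_add.comp (fst.comp snd) (snd.comp snd))
  set s := fun n => ((List.finRange m).map fun i => f i n).foldr (· + ·) 0 with hsd
  -- The partial sums of `s` are monotone and dominate `s`, which in turn dominates each `f i`.
  refine ⟨fun n => Nat.rec (motive := fun _ => ℕ) (s 0) (fun k a => a + s (k + 1)) n, ?_, ?_, ?_⟩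
  · exact nat_rec (h := fun _ (p : ℕ × ℕ) => p.2 + s (p.1 + 1)) Computable.id (const (s 0))
      (nat_add.comp (snd.comp snd) (hs.comp (succ.comp (fst.comp snd))))
  · exact monotone_nat_of_le_succ fun n => Nat.le_add_right _ _
  · intro i n
    have h1 : f i n ≤ s n := by
      have : f i n ∈ (List.finRange m).map fun i => f i n := List.mem_map.2 ⟨i, by simp, rfl⟩
      exact List.le_sum_of_mem this
    cases n with
    | zero => exact h1
    | succ n => exact h1.trans (Nat.le_add_left _ _)

/-! ### Recursively enumerable predicates and totalisation -/

theorem rePred_comp {p : β → Prop} {f : α → β} (hp : REPred p) (hf : Computable f) :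
    REPred fun a => p (f a) :=
  Partrec.comp (f := fun b => Part.assert (p b) fun _ => Part.some ()) hp hf

/-- Two recursively enumerable predicates that cover everything can be separated computably. -/
theorem exists_separation {p q : α → Prop} (hp : REPred p) (hq : REPred q)
    (h : ∀ a, p a ∨ q a) :
    ∃ t : α → Bool, Computable t ∧ ∀ a, (t a = true → p a) ∧ (t a = false → q a) := by
  -- Both semi-decision procedures run in parallel; the answer records one that has halted.
  obtain ⟨k, hk, H⟩ := Partrec.merge' (hp.map (const true).to₂) (hq.map (const false).to₂)
  have hd : ∀ a, (k a).Dom := fun a => (H a).2.2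
    ((h a).imp (fun h => ⟨h, trivial⟩) fun h => ⟨h, trivial⟩)
  refine ⟨fun a => (k a).get (hd a), hk.of_eq_tot fun a => Part.get_mem _, fun a => ?_⟩
  have := (H a).1 _ (Part.get_mem (hd a))
  constructor <;> intro e <;> dsimp only at e <;> rw [e] at this <;>
    simpa [Part.mem_map_iff] using this

/-- A partial computable function that is defined on a decidable set extends to a total one. -/
theorem exists_total [Inhabited σ] {f : α →. σ} (hf : Partrec f) {p : α → Prop}
    (hp : ComputablePred p) (h : ∀ a, p a → (f a).Dom) :
    ∃ g : α → σ, Computable g ∧ ∀ a, p a → g a ∈ f a := by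
  obtain ⟨_, hp⟩ := hp
  have hk : Partrec fun a => bif decide (p a) then f a else Part.some default :=
    Partrec.cond hp hf (const default)
  have hd : ∀ a, (bif decide (p a) then f a else Part.some default).Dom := by
    intro a
    by_cases ha : p a <;> simp [ha, h]
  refine ⟨fun a => (bif decide (p a) then f a else Part.some default).get (hd a),
    hk.of_eq_tot fun a => Part.get_mem _, fun a ha => ?_⟩
  have := Part.get_mem (hd a)
  change Part.get _ (hd a) ∈ f a
  generalize Part.get _ (hd a) = x at this ⊢
  simpa [ha] using this

end Computable

namespace DigitSpace

/-! ### Codes of dyadic rationals -/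

/-- The code of `2⁻ᵏ`. -/
def dyadic (k : ℕ) : ℕ × ℕ := (0, 2 ^ k - 1)

theorem computable_dyadic : Computable dyadic :=
  (Computable.const 0).pair (Computable.pred.comp Computable.two_pow)

theorem cast_two_pow_pred (k : ℕ) : ((2 ^ k - 1 : ℕ) : ℝ) + 1 = 2 ^ k := by
  rw [Nat.cast_sub Nat.one_le_two_pow]
  simp

theorem posRat_dyadic (k : ℕ) : (posRat (dyadic k) : ℝ) = (2 : ℝ)⁻¹ ^ k := by
  have := cast_two_pow_pred k
  simp only [posRat, dyadic, Rat.cast_div, Rat.cast_add, Rat.cast_natCast, Rat.cast_one]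
  rw [this]
  simp

/-- Turns a rational modulus into an exponent: the second component of the code is already large
enough, since `b + 1 ≤ 2ᵇ`. -/
theorem inv_two_pow_le_posRat (t : ℕ × ℕ) : (2 : ℝ)⁻¹ ^ t.2 ≤ (posRat t : ℝ) := by
  simp only [posRat, Rat.cast_div, Rat.cast_add, Rat.cast_natCast, Rat.cast_one, inv_pow]
  rw [inv_eq_one_div]
  have : (t.2 : ℝ) + 1 ≤ 2 ^ t.2 := by exact_mod_cast Nat.lt_two_pow_self
  gcongr
  simp

/-- Basic elements can be compared computably with respect to two different thresholds. -/
theorem IsComputableMetric.exists_near {X I : Type*} [MetricSpace X] [Primcodable I] {u : I → X}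
    (hu : IsComputableMetric u) :
    ∃ t : (I × I) × ℕ → Bool, Computable t ∧ ∀ i j k,
      (t ((i, j), k) = true → dist (u i) (u j) < 2 * (2 : ℝ)⁻¹ ^ k) ∧
      (dist (u i) (u j) ≤ 3 / 2 * (2 : ℝ)⁻¹ ^ k → t ((i, j), k) = true) := by
  have c1 : Computable fun p : (I × I) × ℕ => (p.1, (2, 0, 2 ^ p.2 - 1)) :=
    .pair .fst (.pair (.const 2) (.pair (.const 0)
      (Computable.pred.comp (Computable.two_pow.comp .snd))))
  have c2 : Computable fun p : (I × I) × ℕ => (p.1, (3, 0, 2 ^ (p.2 + 1) - 1)) :=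
    .pair .fst (.pair (.const 3) (.pair (.const 0)
      (Computable.pred.comp (Computable.two_pow.comp (Computable.succ.comp .snd)))))
  have e1 : ∀ k, (ratCode (2, 0, 2 ^ k - 1) : ℝ) = 2 * (2 : ℝ)⁻¹ ^ k := by
    intro k
    have := cast_two_pow_pred k
    simp only [ratCode, Rat.cast_div, Rat.cast_add, Rat.cast_natCast, Rat.cast_one, Rat.cast_sub]
    rw [this]
    simp [div_eq_mul_inv]
  have e2 : ∀ k, (ratCode (3, 0, 2 ^ (k + 1) - 1) : ℝ) = 3 / 2 * (2 : ℝ)⁻¹ ^ k := by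
    intro k
    have := cast_two_pow_pred (k + 1)
    simp only [ratCode, Rat.cast_div, Rat.cast_add, Rat.cast_natCast, Rat.cast_one, Rat.cast_sub]
    rw [this]
    simp [div_eq_mul_inv, pow_succ]
    ring
  -- The two conditions overlap because `3/2 < 2`, hence one of them always holds.
  obtain ⟨t, ht, h⟩ := Computable.exists_separation
    (p := fun p : (I × I) × ℕ => dist (u p.1.1) (u p.1.2) < 2 * (2 : ℝ)⁻¹ ^ p.2)
    (q := fun p : (I × I) × ℕ => 3 / 2 * (2 : ℝ)⁻¹ ^ p.2 < dist (u p.1.1) (u p.1.2))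
    (REPred.of_eq (Computable.rePred_comp hu.re_lt c1) fun p => by simp only [e1])
    (REPred.of_eq (Computable.rePred_comp hu.re_gt c2) fun p => by simp only [e2])
    fun p => by
      have : (0 : ℝ) < (2 : ℝ)⁻¹ ^ p.2 := by positivity
      rcases lt_or_ge (dist (u p.1.1) (u p.1.2)) (2 * (2 : ℝ)⁻¹ ^ p.2) with h | h
      · exact Or.inl h
      · right; linarith
  refine ⟨t, ht, fun i j k => ⟨(h ((i, j), k)).1, fun hd => ?_⟩⟩
  by_contra hf
  exact absurd ((h ((i, j), k)).2 (by simpa using hf)) (not_lt.2 hd)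

end DigitSpace

namespace DigitSpace

open Filter Topology

/-! ### Finite sets and limits in the hyperspace -/

section Hyperspace

variable {X : Type*} [MetricSpace X]

theorem dist_le_of_forall_exists {K L : NonemptyCompacts X} {r : ℝ} (hr : 0 ≤ r)
    (h₁ : ∀ x ∈ K, ∃ y ∈ L, dist x y ≤ r) (h₂ : ∀ y ∈ L, ∃ x ∈ K, dist x y ≤ r) :
    dist K L ≤ r := by
  rw [Metric.NonemptyCompacts.dist_eq]
  refine Metric.hausdorffDist_le_of_mem_dist hr h₁ fun y hy => ?_
  obtain ⟨x, hx, h⟩ := h₂ y hy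
  exact ⟨x, hx, by rwa [dist_comm]⟩

theorem exists_mem_dist_lt {K L : NonemptyCompacts X} {r : ℝ} (h : dist K L < r) {x : X}
    (hx : x ∈ K) : ∃ y ∈ L, dist x y < r := by
  rw [Metric.NonemptyCompacts.dist_eq] at h
  exact Metric.exists_dist_lt_of_hausdorffDist_lt hx h
    (Metric.hausdorffEDist_ne_top_of_nonempty_of_bounded K.nonempty L.nonempty
      K.isCompact.isBounded L.isCompact.isBounded)

theorem mem_of_forall_exists_dist_lt {K : NonemptyCompacts X} {x : X}
    (h : ∀ ε > 0, ∃ y ∈ K, dist x y < ε) : x ∈ K := by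
  have : x ∈ closure (K : Set X) := Metric.mem_closure_iff.2 h
  rwa [K.isCompact.isClosed.closure_eq] at this

theorem exists_limit_of_geometric {Y : Type*} [MetricSpace Y] [CompleteSpace Y] {f : ℕ → Y}
    {C : ℝ} (h : ∀ n, dist (f n) (f (n + 1)) ≤ C * (2 : ℝ)⁻¹ ^ n) :
    ∃ a, Tendsto f atTop (𝓝 a) ∧ ∀ n, dist (f n) a ≤ 2 * C * (2 : ℝ)⁻¹ ^ n := by
  have h' : ∀ n, dist (f n) (f (n + 1)) ≤ (2 * C) / 2 / 2 ^ n := fun n => by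
    simpa [div_eq_mul_inv, mul_comm] using h n
  obtain ⟨a, ha⟩ := cauchySeq_tendsto_of_complete (cauchySeq_of_le_geometric_two h')
  refine ⟨a, ha, fun n => ?_⟩
  simpa [div_eq_mul_inv, mul_comm] using dist_le_of_le_geometric_two_of_tendsto h' ha n

theorem inv_two_pow_succ (n : ℕ) : (2 : ℝ)⁻¹ ^ (n + 1) = (2 : ℝ)⁻¹ ^ n / 2 := by
  rw [pow_succ, div_eq_mul_inv]

theorem inv_two_pow_pos (n : ℕ) : (0 : ℝ) < (2 : ℝ)⁻¹ ^ n := by positivity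

theorem inv_two_pow_anti {k n : ℕ} (h : k ≤ n) : (2 : ℝ)⁻¹ ^ n ≤ (2 : ℝ)⁻¹ ^ k :=
  pow_le_pow_of_le_one (by norm_num) (by norm_num) h

theorem tendsto_inv_two_pow : Tendsto (fun n : ℕ => (2 : ℝ)⁻¹ ^ n) atTop (𝓝 0) :=
  tendsto_pow_atTop_nhds_zero_of_lt_one (by norm_num) (by norm_num)

/-- The finite set of the basic elements with indices in `l`. -/
def finiteSet (u : ℕ → X) (l : List ℕ) : NonemptyCompacts X := basicSubset u (l.headI, l.tail)

/-- For `l = []` the default of `headI` makes the set `{u 0}`, hence the non-emptiness conditions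
throughout. -/
theorem mem_finiteSet {u : ℕ → X} {l : List ℕ} (hl : l ≠ []) {x : X} :
    x ∈ finiteSet u l ↔ ∃ i ∈ l, x = u i := by
  have h : l.headI :: l.tail = l := by cases l <;> simp_all
  change (∃ i ∈ l.headI :: l.tail, x = u i) ↔ _
  rw [h]

/-- The sequence `W` of lists of indices names the compact set `K`. -/
def Names (u : ℕ → X) (W : ℕ → List ℕ) (K : NonemptyCompacts X) : Prop :=
  ∀ n, W n ≠ [] ∧ dist K (finiteSet u (W n)) < (2 : ℝ)⁻¹ ^ n

theorem Names.exists_mem {u : ℕ → X} {W : ℕ → List ℕ} {K : NonemptyCompacts X}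
    (h : Names u W K) (n : ℕ) {x : X} (hx : x ∈ K) :
    ∃ i ∈ W n, dist x (u i) < (2 : ℝ)⁻¹ ^ n := by
  obtain ⟨y, hy, hd⟩ := exists_mem_dist_lt (h n).2 hx
  obtain ⟨i, hi, rfl⟩ := (mem_finiteSet (h n).1).1 hy
  exact ⟨i, hi, hd⟩

theorem Names.exists_near {u : ℕ → X} {W : ℕ → List ℕ} {K : NonemptyCompacts X}
    (h : Names u W K) {n i : ℕ} (hi : i ∈ W n) :
    ∃ x ∈ K, dist (u i) x < (2 : ℝ)⁻¹ ^ n := by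
  have h2 := (h n).2
  rw [dist_comm] at h2
  exact exists_mem_dist_lt h2 ((mem_finiteSet (h n).1).2 ⟨i, hi, rfl⟩)

theorem dist_finiteSet_le {u : ℕ → X} {l l' : List ℕ} (hl : l ≠ []) (hl' : l' ≠ []) {r : ℝ}
    (hr : 0 ≤ r) (h₁ : ∀ i ∈ l, ∃ j ∈ l', dist (u i) (u j) ≤ r)
    (h₂ : ∀ j ∈ l', ∃ i ∈ l, dist (u i) (u j) ≤ r) :
    dist (finiteSet u l) (finiteSet u l') ≤ r := by
  refine dist_le_of_forall_exists hr (fun x hx => ?_) fun y hy => ?_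
  · obtain ⟨i, hi, rfl⟩ := (mem_finiteSet hl).1 hx
    obtain ⟨j, hj, h⟩ := h₁ i hi
    exact ⟨_, (mem_finiteSet hl').2 ⟨j, hj, rfl⟩, h⟩
  · obtain ⟨j, hj, rfl⟩ := (mem_finiteSet hl').1 hy
    obtain ⟨i, hi, h⟩ := h₂ j hj
    exact ⟨_, (mem_finiteSet hl).2 ⟨i, hi, rfl⟩, h⟩

theorem exists_index_dist_lt {u : ℕ → X} {l l' : List ℕ} (hl : l ≠ []) (hl' : l' ≠ []) {r : ℝ}
    (h : dist (finiteSet u l) (finiteSet u l') < r) {i : ℕ} (hi : i ∈ l) :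
    ∃ j ∈ l', dist (u i) (u j) < r := by
  obtain ⟨y, hy, hd⟩ := exists_mem_dist_lt h ((mem_finiteSet hl).2 ⟨i, hi, rfl⟩)
  obtain ⟨j, hj, rfl⟩ := (mem_finiteSet hl').1 hy
  exact ⟨j, hj, hd⟩

end Hyperspace

/-! ### Splitting a compact set along the digits -/

/-- The ingredients of the algorithm that splits a compact set along the ranges of the digits:
`2⁻ᶜ` is a Lebesgue number, `sel` decides whether a ball of this radius is contained in the range
of a digit, `near` compares distances, `J` is a modulus and `pick` chooses preimages. -/
structure Splitter (m : ℕ) where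
  c : ℕ
  sel : Fin m → ℕ → Bool
  near : ℕ → ℕ → ℕ → Bool
  J : ℕ → ℕ
  pick : Fin m → ℕ → ℕ → ℕ

namespace Splitter

variable {m : ℕ} (P : Splitter m)

/-- The points of the `j`-th approximation that are connected with selected points. -/
def thin (d : Fin m) (W : ℕ → List ℕ) : ℕ → List ℕ
  | 0 => (W (P.c + 5)).filter (P.sel d)
  | j + 1 => (W (P.c + 5 + (j + 1))).filter fun i' =>
      (thin d W j).any fun i => P.near i i' (P.c + 5 + j)

/-- The name of the part of the compact set that belongs to the digit `d`. -/
def child (d : Fin m) (W : ℕ → List ℕ) (n : ℕ) : List ℕ :=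
  (P.thin d W (P.J n)).map (P.pick d n)

/-- The digits needed for covering the compact set. -/
def digits (W : ℕ → List ℕ) : List (Fin m) :=
  (List.finRange m).filter fun d => (W (P.c + 5)).any (P.sel d)

variable {X : Type*} [MetricSpace X]

/-- Correctness of a splitter for a system of self-maps `f d` with respect to basic elements `u i`.
-/
structure Correct (P : Splitter m) (f : Fin m → X → X) (u : ℕ → X) : Prop where
  lebesgue : ∀ x, ∃ d, Metric.ball x ((2 : ℝ)⁻¹ ^ P.c) ⊆ Set.range (f d)
  sel_iff : ∀ d i, P.sel d i = true ↔ Metric.ball (u i) ((2 : ℝ)⁻¹ ^ P.c) ⊆ Set.range (f d)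
  near_lt : ∀ i j k, P.near i j k = true → dist (u i) (u j) < 2 * (2 : ℝ)⁻¹ ^ k
  near_of_le : ∀ i j k, dist (u i) (u j) ≤ 3 / 2 * (2 : ℝ)⁻¹ ^ k → P.near i j k = true
  mono : Monotone P.J
  le_J : ∀ n, n ≤ P.J n
  pick_modulus : ∀ d n i j, Metric.ball (u i) ((2 : ℝ)⁻¹ ^ (P.c + 1)) ⊆ Set.range (f d) →
    Metric.ball (u j) ((2 : ℝ)⁻¹ ^ (P.c + 1)) ⊆ Set.range (f d) →
    dist (u i) (u j) < (2 : ℝ)⁻¹ ^ P.J n →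
    dist (u (P.pick d n i)) (u (P.pick d n j)) < (2 : ℝ)⁻¹ ^ (n + 3)
  pick_succ : ∀ d n i, Metric.ball (u i) ((2 : ℝ)⁻¹ ^ (P.c + 1)) ⊆ Set.range (f d) →
    dist (u (P.pick d n i)) (u (P.pick d (n + 1) i)) < (2 : ℝ)⁻¹ ^ (n + 3)
  pick_spec : ∀ d n i, Metric.ball (u i) ((2 : ℝ)⁻¹ ^ (P.c + 1)) ⊆ Set.range (f d) →
    ∃ y, f d y = u i ∧ dist y (u (P.pick d n i)) < (2 : ℝ)⁻¹ ^ (n + 3)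
  lipschitz : ∀ d, LipschitzWith 1 (f d)

variable {P} {f : Fin m → X → X} {u : ℕ → X} {W : ℕ → List ℕ} {K : NonemptyCompacts X}
  {d : Fin m}

theorem mem_digits : d ∈ P.digits W ↔ ∃ i ∈ W (P.c + 5), P.sel d i = true := by
  simp [digits]

theorem nodup_digits : (P.digits W).Nodup := (List.nodup_finRange m).filter _

theorem mem_of_mem_thin {j i : ℕ} (h : i ∈ P.thin d W j) : i ∈ W (P.c + 5 + j) := by
  cases j with
  | zero => exact List.mem_of_mem_filter h
  | succ j => exact List.mem_of_mem_filter h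

theorem mem_thin_succ {j i : ℕ} : i ∈ P.thin d W (j + 1) ↔
    i ∈ W (P.c + 5 + (j + 1)) ∧ ∃ i' ∈ P.thin d W j, P.near i' i (P.c + 5 + j) = true := by
  simp [thin]

/-! ### Convergence of the thinned lists and of the chosen preimages -/

namespace Correct

/-- With `ε = 2⁻⁽ᶜ⁺⁵⁺ʲ⁾`, a kept point is `ε`-close to some point of `K`, which is `ε/2`-close to
the next approximation. The total `3ε/2` is within what `near` is bound to accept. -/
theorem exists_mem_thin_succ (hP : P.Correct f u) (hW : Names u W K) {j i : ℕ}
    (hi : i ∈ P.thin d W j) :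
    ∃ i' ∈ P.thin d W (j + 1), dist (u i) (u i') ≤ 2 * (2 : ℝ)⁻¹ ^ (P.c + 5 + j) := by
  obtain ⟨x, hx, h₁⟩ := hW.exists_near (mem_of_mem_thin hi)
  obtain ⟨i', hi', h₂⟩ := hW.exists_mem (P.c + 5 + (j + 1)) hx
  have h : dist (u i) (u i') ≤ 3 / 2 * (2 : ℝ)⁻¹ ^ (P.c + 5 + j) := by
    rw [← add_assoc, inv_two_pow_succ] at h₂
    linarith [dist_triangle (u i) x (u i')]
  exact ⟨i', mem_thin_succ.2 ⟨hi', i, hi, hP.near_of_le _ _ _ h⟩,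
    h.trans (by linarith [inv_two_pow_pos (P.c + 5 + j)])⟩

theorem thin_ne_nil (hP : P.Correct f u) (hW : Names u W K) (hd : d ∈ P.digits W) (j : ℕ) :
    P.thin d W j ≠ [] := by
  induction j with
  | zero =>
    obtain ⟨i, hi, hs⟩ := mem_digits.1 hd
    exact List.ne_nil_of_mem (List.mem_filter.2 ⟨hi, hs⟩)
  | succ j ih =>
    obtain ⟨i, hi⟩ := List.exists_mem_of_ne_nil _ ih
    obtain ⟨i', hi', -⟩ := hP.exists_mem_thin_succ hW hi
    exact List.ne_nil_of_mem hi'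

/-- Forwards no kept point is lost, backwards `near` provides a predecessor, so consecutive lists
have Hausdorff distance at most `2⁻⁽ᶜ⁺⁴⁾ · 2⁻ʲ`; the tail of the geometric series doubles this. -/
theorem exists_limit_thin [CompactSpace X] (hP : P.Correct f u) (hW : Names u W K)
    (hd : d ∈ P.digits W) :
    ∃ L : NonemptyCompacts X, ∀ j,
      dist (finiteSet u (P.thin d W j)) L ≤ (2 : ℝ)⁻¹ ^ (P.c + 3) * (2 : ℝ)⁻¹ ^ j := by
  obtain ⟨L, -, hL⟩ := exists_limit_of_geometric (f := fun j => finiteSet u (P.thin d W j))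
    (C := (2 : ℝ)⁻¹ ^ (P.c + 4)) fun j => by
      have e : 2 * (2 : ℝ)⁻¹ ^ (P.c + 5 + j) = (2 : ℝ)⁻¹ ^ (P.c + 4) * (2 : ℝ)⁻¹ ^ j := by
        rw [pow_add, inv_two_pow_succ]; ring
      rw [← e]
      refine dist_finiteSet_le (hP.thin_ne_nil hW hd _) (hP.thin_ne_nil hW hd _) (by positivity)
        (fun i hi => hP.exists_mem_thin_succ hW hi) fun i hi => ?_
      obtain ⟨-, i', hi', h⟩ := mem_thin_succ.1 hi
      exact ⟨i', hi', (hP.near_lt _ _ _ h).le⟩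
  refine ⟨L, fun j => (hL j).trans (le_of_eq ?_)⟩
  rw [inv_two_pow_succ (P.c + 3)]
  ring

theorem dist_thin_lt [CompactSpace X] (hP : P.Correct f u) (hW : Names u W K)
    (hd : d ∈ P.digits W) {j k : ℕ} (h : j ≤ k) :
    dist (finiteSet u (P.thin d W j)) (finiteSet u (P.thin d W k)) <
      (2 : ℝ)⁻¹ ^ (P.c + 1) * (2 : ℝ)⁻¹ ^ j := by
  obtain ⟨L, hL⟩ := hP.exists_limit_thin hW hd
  have h₁ := hL j
  have h₂ := hL k
  have h₃ := inv_two_pow_anti h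
  have h₄ := dist_triangle_right (finiteSet u (P.thin d W j)) (finiteSet u (P.thin d W k)) L
  have e : (2 : ℝ)⁻¹ ^ (P.c + 3) = (2 : ℝ)⁻¹ ^ (P.c + 1) / 4 := by
    rw [inv_two_pow_succ, inv_two_pow_succ (P.c + 1)]; ring
  rw [e] at h₁ h₂
  nlinarith [inv_two_pow_pos (P.c + 1), inv_two_pow_pos j,
    mul_pos (inv_two_pow_pos (P.c + 1)) (inv_two_pow_pos j),
    mul_le_mul_of_nonneg_left h₃ (inv_two_pow_pos (P.c + 1)).le]

/-- The reason for starting at `c + 5`: the total drift from the selected points stays below half of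
the Lebesgue radius, so the other half remains as a ball inside the range and preimages can be
chosen at every stage. -/
theorem ball_subset_of_mem_thin [CompactSpace X] (hP : P.Correct f u) (hW : Names u W K)
    (hd : d ∈ P.digits W) {j i : ℕ} (hi : i ∈ P.thin d W j) :
    Metric.ball (u i) ((2 : ℝ)⁻¹ ^ (P.c + 1)) ⊆ Set.range (f d) := by
  have h := hP.dist_thin_lt hW hd (Nat.zero_le j)
  rw [dist_comm, pow_zero, mul_one] at h
  obtain ⟨i₀, hi₀, hd₀⟩ := exists_index_dist_lt (hP.thin_ne_nil hW hd _)
    (hP.thin_ne_nil hW hd _) h hi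
  refine Set.Subset.trans (Metric.ball_subset_ball' ?_)
    ((hP.sel_iff d i₀).1 (List.mem_filter.1 hi₀).2)
  rw [inv_two_pow_succ] at hd₀ ⊢
  linarith

theorem dist_thin_J_lt [CompactSpace X] (hP : P.Correct f u) (hW : Names u W K)
    (hd : d ∈ P.digits W) (n : ℕ) :
    dist (finiteSet u (P.thin d W (P.J n))) (finiteSet u (P.thin d W (P.J (n + 1)))) <
      (2 : ℝ)⁻¹ ^ P.J n := by
  refine (hP.dist_thin_lt hW hd (hP.mono n.le_succ)).trans_le ?_
  exact mul_le_of_le_one_left (inv_two_pow_pos _).le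
    (pow_le_one₀ (by norm_num) (by norm_num))

/-- Two moves of size `2⁻⁽ⁿ⁺³⁾`: first change the base point at fixed precision, by the modulus of
choice, then change the precision at fixed base point. -/
theorem dist_pick_le [CompactSpace X] (hP : P.Correct f u) (hW : Names u W K)
    (hd : d ∈ P.digits W) {n j k i i' : ℕ} (hi : i ∈ P.thin d W j) (hi' : i' ∈ P.thin d W k)
    (h : dist (u i) (u i') < (2 : ℝ)⁻¹ ^ P.J n) :
    dist (u (P.pick d n i)) (u (P.pick d (n + 1) i')) ≤ (2 : ℝ)⁻¹ ^ 2 * (2 : ℝ)⁻¹ ^ n := by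
  have b := hP.ball_subset_of_mem_thin hW hd hi
  have b' := hP.ball_subset_of_mem_thin hW hd hi'
  have h₁ := hP.pick_modulus d n i i' b b' h
  have h₂ := hP.pick_succ d n i' b'
  have e : (2 : ℝ)⁻¹ ^ 2 * (2 : ℝ)⁻¹ ^ n = 2 * (2 : ℝ)⁻¹ ^ (n + 3) := by ring
  rw [e]
  linarith [dist_triangle (u (P.pick d n i)) (u (P.pick d n i')) (u (P.pick d (n + 1) i'))]

theorem child_ne_nil (hP : P.Correct f u) (hW : Names u W K) (hd : d ∈ P.digits W) (n : ℕ) :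
    P.child d W n ≠ [] := by
  simpa [child] using hP.thin_ne_nil hW hd (P.J n)

/-- The step bound `2⁻² · 2⁻ⁿ` sums to `2⁻⁽ⁿ⁺¹⁾`, which leaves room for the strict bound `2⁻ⁿ`
required of a name. -/
theorem exists_limit_child [CompactSpace X] (hP : P.Correct f u) (hW : Names u W K)
    (hd : d ∈ P.digits W) :
    ∃ L : NonemptyCompacts X, ∀ n,
      dist (finiteSet u (P.child d W n)) L ≤ (2 : ℝ)⁻¹ ^ (n + 1) := by
  obtain ⟨L, -, hL⟩ := exists_limit_of_geometric (f := fun n => finiteSet u (P.child d W n))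
    (C := (2 : ℝ)⁻¹ ^ 2) fun n => by
      have h := hP.dist_thin_J_lt hW hd n
      refine dist_finiteSet_le (hP.child_ne_nil hW hd _) (hP.child_ne_nil hW hd _)
        (by positivity) (fun i hi => ?_) fun i hi => ?_
      · obtain ⟨a, ha, rfl⟩ := List.mem_map.1 hi
        obtain ⟨b, hb, hab⟩ := exists_index_dist_lt (hP.thin_ne_nil hW hd _)
          (hP.thin_ne_nil hW hd _) h ha
        exact ⟨_, List.mem_map_of_mem hb, hP.dist_pick_le hW hd ha hb hab⟩
      · obtain ⟨b, hb, rfl⟩ := List.mem_map.1 hi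
        rw [dist_comm] at h
        obtain ⟨a, ha, hab⟩ := exists_index_dist_lt (hP.thin_ne_nil hW hd _)
          (hP.thin_ne_nil hW hd _) h hb
        exact ⟨_, List.mem_map_of_mem ha,
          hP.dist_pick_le hW hd ha hb (by rwa [dist_comm])⟩
  refine ⟨L, fun n => (hL n).trans (le_of_eq ?_)⟩
  ring

/-- Chosen points are close to exact preimages and `f d` is non-expansive, so the images of the
children approach the same limit as the thinned lists; continuity of the image map identifies the
limits. -/
theorem image_limit_eq [CompactSpace X] (hP : P.Correct f u) (hW : Names u W K)
    (hd : d ∈ P.digits W) {L L' : NonemptyCompacts X}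
    (hL : ∀ j, dist (finiteSet u (P.thin d W j)) L ≤ (2 : ℝ)⁻¹ ^ (P.c + 3) * (2 : ℝ)⁻¹ ^ j)
    (hL' : ∀ n, dist (finiteSet u (P.child d W n)) L' ≤ (2 : ℝ)⁻¹ ^ (n + 1)) :
    (L'.map (f d) (hP.lipschitz d).continuous) = L := by
  have hc : Tendsto (fun n => finiteSet u (P.child d W n)) atTop (𝓝 L') := by
    rw [tendsto_iff_dist_tendsto_zero]
    exact squeeze_zero (fun _ => dist_nonneg) hL'
      ((tendsto_add_atTop_iff_nat 1).2 tendsto_inv_two_pow)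
  have h₁ := ((hP.lipschitz d).continuous.nonemptyCompacts_map.tendsto L').comp hc
  refine tendsto_nhds_unique h₁ ?_
  rw [tendsto_iff_dist_tendsto_zero]
  refine squeeze_zero (g := fun n => 2 * (2 : ℝ)⁻¹ ^ n) (fun _ => dist_nonneg) (fun n => ?_)
    (by simpa using tendsto_inv_two_pow.const_mul 2)
  have h₂ : dist (finiteSet u (P.thin d W (P.J n))) L ≤ (2 : ℝ)⁻¹ ^ n :=
    (hL _).trans ((mul_le_of_le_one_left (inv_two_pow_pos _).le
      (pow_le_one₀ (by norm_num) (by norm_num))).trans (inv_two_pow_anti (hP.le_J n)))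
  have key : ∀ i ∈ P.thin d W (P.J n), dist (f d (u (P.pick d n i))) (u i) ≤ (2 : ℝ)⁻¹ ^ n := by
    intro i hi
    obtain ⟨y, hy, hyd⟩ := hP.pick_spec d n i (hP.ball_subset_of_mem_thin hW hd hi)
    have := (hP.lipschitz d).dist_le_mul (u (P.pick d n i)) y
    rw [hy, dist_comm (u (P.pick d n i))] at this
    have h₄ := inv_two_pow_anti (Nat.le_add_right n 3)
    simp only [NNReal.coe_one, one_mul] at this
    linarith
  have h₃ : dist ((finiteSet u (P.child d W n)).map (f d) (hP.lipschitz d).continuous)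
      (finiteSet u (P.thin d W (P.J n))) ≤ (2 : ℝ)⁻¹ ^ n := by
    refine dist_le_of_forall_exists (inv_two_pow_pos n).le (fun x hx => ?_) fun y hy => ?_
    · rw [← SetLike.mem_coe, NonemptyCompacts.coe_map] at hx
      obtain ⟨z, hz, rfl⟩ := hx
      obtain ⟨k, hk, rfl⟩ := (mem_finiteSet (hP.child_ne_nil hW hd _)).1 hz
      obtain ⟨i, hi, rfl⟩ := List.mem_map.1 hk
      exact ⟨u i, (mem_finiteSet (hP.thin_ne_nil hW hd _)).2 ⟨i, hi, rfl⟩, key i hi⟩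
    · obtain ⟨i, hi, rfl⟩ := (mem_finiteSet (hP.thin_ne_nil hW hd _)).1 hy
      refine ⟨f d (u (P.pick d n i)), ?_, key i hi⟩
      rw [← SetLike.mem_coe, NonemptyCompacts.coe_map]
      exact ⟨_, (mem_finiteSet (hP.child_ne_nil hW hd _)).2
        ⟨_, List.mem_map_of_mem hi, rfl⟩, rfl⟩
  simp only [Function.comp]
  linarith [dist_triangle ((finiteSet u (P.child d W n)).map (f d) (hP.lipschitz d).continuous)
      (finiteSet u (P.thin d W (P.J n))) L]

/-- Follow a sequence of approximants of `x`. The Lebesgue number, applied to the first approximant,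
provides a digit selecting it; consecutive approximants are close enough for `near`, so the whole
sequence is kept for that digit. -/
theorem exists_mem_limit (hP : P.Correct f u) (hW : Names u W K) {x : X} (hx : x ∈ K) :
    ∃ d ∈ P.digits W, ∀ j, ∃ i ∈ P.thin d W j, dist x (u i) < (2 : ℝ)⁻¹ ^ j := by
  choose w hw hwd using fun j => hW.exists_mem (P.c + 5 + j) hx
  obtain ⟨d, hd⟩ := hP.lebesgue (u (w 0))
  have hs : P.sel d (w 0) = true := (hP.sel_iff _ _).2 hd
  refine ⟨d, mem_digits.2 ⟨_, hw 0, hs⟩, fun j =>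
    ⟨w j, ?_, (hwd j).trans_le (inv_two_pow_anti (Nat.le_add_left _ _))⟩⟩
  induction j with
  | zero => exact List.mem_filter.2 ⟨hw 0, hs⟩
  | succ j ih =>
    refine mem_thin_succ.2 ⟨hw _, _, ih, hP.near_of_le _ _ _ ?_⟩
    have h₁ := hwd j
    have h₂ := hwd (j + 1)
    rw [← add_assoc, inv_two_pow_succ] at h₂
    linarith [dist_triangle_left (u (w j)) (u (w (j + 1))) x]

/-- A name of a compact set is split into names of compact sets whose images under the selected
digits cover it. -/
theorem exists_split [CompactSpace X] (hP : P.Correct f u) (hW : Names u W K) :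
    ∃ L : Fin m → NonemptyCompacts X, (∀ d ∈ P.digits W, Names u (P.child d W) (L d)) ∧
      (K : Set X) = ⋃ d ∈ P.digits W, f d '' (L d : Set X) := by
  have key : ∀ d, ∃ L' : NonemptyCompacts X, d ∈ P.digits W → Names u (P.child d W) L' ∧
      ∀ j, dist (finiteSet u (P.thin d W j)) (L'.map (f d) (hP.lipschitz d).continuous) ≤
        (2 : ℝ)⁻¹ ^ (P.c + 3) * (2 : ℝ)⁻¹ ^ j := by
    intro d
    by_cases hd : d ∈ P.digits W
    · obtain ⟨L, hL⟩ := hP.exists_limit_thin hW hd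
      obtain ⟨L', hL'⟩ := hP.exists_limit_child hW hd
      refine ⟨L', fun _ => ⟨fun n => ⟨hP.child_ne_nil hW hd n, ?_⟩, ?_⟩⟩
      · rw [dist_comm]
        refine (hL' n).trans_lt ?_
        rw [inv_two_pow_succ]
        linarith [inv_two_pow_pos n]
      · rw [hP.image_limit_eq hW hd hL hL']
        exact hL
    -- An arbitrary value for digits that do not occur.
    · exact ⟨K, fun h => absurd h hd⟩
  choose L hL using key
  have small : ∀ ε > 0, ∃ j : ℕ, (2 : ℝ)⁻¹ ^ j < ε := fun ε hε =>
    exists_pow_lt_of_lt_one hε (by norm_num)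
  have hle : ∀ d ∈ P.digits W, ∀ j, dist (finiteSet u (P.thin d W j))
      ((L d).map (f d) (hP.lipschitz d).continuous) ≤ (2 : ℝ)⁻¹ ^ j := fun d hd j =>
    ((hL d hd).2 j).trans (mul_le_of_le_one_left (inv_two_pow_pos _).le
      (pow_le_one₀ (by norm_num) (by norm_num)))
  refine ⟨L, fun d hd => (hL d hd).1, Set.Subset.antisymm (fun x hx => ?_) fun x hx => ?_⟩
  · obtain ⟨d, hd, h⟩ := hP.exists_mem_limit hW hx
    refine Set.mem_iUnion₂.2 ⟨d, hd, ?_⟩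
    rw [← NonemptyCompacts.coe_map (hP.lipschitz d).continuous]
    refine mem_of_forall_exists_dist_lt fun ε hε => ?_
    obtain ⟨j, hj⟩ := small (ε / 4) (by linarith)
    obtain ⟨i, hi, hxi⟩ := h j
    obtain ⟨y, hy, hyd⟩ := exists_mem_dist_lt ((hle d hd j).trans_lt (hj.trans
      (by linarith : ε / 4 < ε / 2))) ((mem_finiteSet (hP.thin_ne_nil hW hd j)).2 ⟨i, hi, rfl⟩)
    exact ⟨y, hy, by linarith [dist_triangle x (u i) y]⟩
  · obtain ⟨d, hd, hx⟩ := Set.mem_iUnion₂.1 hx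
    rw [← NonemptyCompacts.coe_map (hP.lipschitz d).continuous] at hx
    refine mem_of_forall_exists_dist_lt fun ε hε => ?_
    obtain ⟨j, hj⟩ := small (ε / 4) (by linarith)
    have h' := hle d hd j
    rw [dist_comm] at h'
    obtain ⟨y, hy, hyd⟩ := exists_mem_dist_lt (h'.trans_lt (hj.trans
      (by linarith : ε / 4 < ε / 2))) hx
    obtain ⟨i, hi, rfl⟩ := (mem_finiteSet (hP.thin_ne_nil hW hd j)).1 hy
    obtain ⟨z, hz, hzd⟩ := hW.exists_near (mem_of_mem_thin hi)
    have := inv_two_pow_anti (Nat.le_add_left j (P.c + 5))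
    exact ⟨z, hz, by linarith [dist_triangle x (u i) z]⟩

theorem digits_ne_nil (hP : P.Correct f u) (hW : Names u W K) : P.digits W ≠ [] := by
  obtain ⟨x, hx⟩ := K.nonempty
  obtain ⟨d, hd, -⟩ := hP.exists_mem_limit hW hx
  exact List.ne_nil_of_mem hd

end Correct

end Splitter

end DigitSpace

namespace DigitSpace

/-! ### From Cauchy names to trees -/

/-- The list of indices with the code `a`. -/
def decodeIndices (a : ℕ) : List ℕ :=
  ((Encodable.decode a : Option (ℕ × List ℕ)).map fun q => q.1 :: q.2).getD []

theorem decodeIndices_encode (q : ℕ × List ℕ) :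
    decodeIndices (Encodable.encode q) = q.1 :: q.2 := by
  rw [decodeIndices, Encodable.encodek]
  rfl

theorem computable_decodeIndices : Computable decodeIndices :=
  Computable.option_getD
    (Computable.option_map Computable.decode
      (Computable.list_cons.comp (Computable.fst.comp Computable.snd)
        (Computable.snd.comp Computable.snd)).to₂)
    (Computable.const [])

/-- A list of digits as a label of a hyperspace digit. -/
def toHyperDigit {D : Type*} [DecidableEq D] (l : List D) : Option (HyperDigit D) :=
  if h : l ≠ [] ∧ l.Nodup then some ⟨l, h⟩ else none

theorem toHyperDigit_eq_some {D : Type*} [DecidableEq D] {l : List D} {e : HyperDigit D} :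
    toHyperDigit l = some e ↔ e.1 = l := by
  unfold toHyperDigit
  split_ifs with h
  · rw [Option.some_inj, Subtype.ext_iff, eq_comm]
  · simp only [false_iff]
    rintro rfl
    exact h e.2

/-- A subtype inherits its codes, so labels can be computed as plain lists without checking that
they are valid. -/
theorem encode_hyperDigit {m : ℕ} (e : HyperDigit (Fin m)) :
    Encodable.encode (some e) = Encodable.encode (some e.1) := rfl

namespace Splitter

variable {m : ℕ} (P : Splitter m)

/-- The labels of the tree that belongs to the name `W`. -/
def label : (ℕ → List ℕ) → List ℕ → Option (List (Fin m))
  | W, [] => some (P.digits W)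
  | W, i :: s => ((P.digits W)[i]?).bind fun d => label (P.child d W) s

theorem isSome_label_append (W : ℕ → List ℕ) (s : List ℕ) (i : ℕ) :
    (P.label W (s ++ [i])).isSome ↔ ∃ E, P.label W s = some E ∧ i < E.length := by
  induction s generalizing W with
  | nil =>
    by_cases h : i < (P.digits W).length <;> simp [label, h]
  | cons j s ih =>
    cases h : (P.digits W)[j]? with
    | none => simp [label, h]
    | some d => simpa [label, h] using ih (P.child d W)

/-- The list `L` as an initial part of a sequence of lists. -/
def entries (L : List (List ℕ)) (i : ℕ) : List ℕ := L.getD i []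

theorem computable_entries : Computable₂ entries := Computable.list_getD []

/-- The prefix `L` has the first `n + 1` members of the sequence `W`. -/
def Agrees (L : List (List ℕ)) (W : ℕ → List ℕ) (n : ℕ) : Prop :=
  ∀ i ≤ n, i < L.length ∧ entries L i = W i

/-- The version of `child` for prefixes; only an initial part of the result is significant. -/
def childPrefix (L : List (List ℕ)) (d : Fin m) : List (List ℕ) :=
  (List.range L.length).map (P.child d (entries L))

/-- One step of the descent into the tree. -/
def descend (o : Option (List (List ℕ))) (i : ℕ) : Option (List (List ℕ)) :=
  o.bind fun L => ((P.digits (entries L))[i]?).map (P.childPrefix L)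

/-- The version of `label` for prefixes. -/
def labelPrefix (L : List (List ℕ)) (s : List ℕ) : Option (List (Fin m)) :=
  (s.foldl P.descend (some L)).map fun L => P.digits (entries L)

/-- The first `modulus n + 1` members of a name determine the first `n + 1` members of its
children. -/
def modulus (n : ℕ) : ℕ := P.c + 5 + P.J n

variable {P} {L : List (List ℕ)} {W W' : ℕ → List ℕ} {d : Fin m}

theorem thin_congr {j : ℕ} (h : ∀ i ≤ P.c + 5 + j, W i = W' i) :
    P.thin d W j = P.thin d W' j := by
  induction j with
  | zero => simp [thin, h (P.c + 5) (by omega)]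
  | succ j ih => simp [thin, ih fun i hi => h i (by omega), h (P.c + 5 + (j + 1)) le_rfl]

theorem digits_congr (h : W (P.c + 5) = W' (P.c + 5)) : P.digits W = P.digits W' := by
  simp [digits, h]

theorem Agrees.child (hJ : Monotone P.J) (hJ' : ∀ n, n ≤ P.J n) {n : ℕ}
    (h : Agrees L W (P.modulus n)) : Agrees (P.childPrefix L d) (P.child d W) n := by
  intro i hi
  have h₁ : P.modulus i ≤ P.modulus n := Nat.add_le_add_left (hJ hi) _
  have h₂ : i ≤ P.modulus n := le_trans ((hJ' i).trans (Nat.le_add_left _ _)) h₁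
  have hl := (h i h₂).1
  refine ⟨by simpa [childPrefix] using hl, ?_⟩
  have : P.child d (entries L) i = P.child d W i := by
    unfold Splitter.child
    rw [thin_congr fun k hk => (h k (hk.trans h₁)).2]
  rw [← this, entries, List.getD_eq_getElem?_getD]
  simp [childPrefix, hl]

/-- The label at the end of the word reads entry `c + 5` of its own name; each letter of the word
costs one application of `modulus` on the way back to the root. -/
theorem labelPrefix_eq (hJ : Monotone P.J) (hJ' : ∀ n, n ≤ P.J n) (s : List ℕ)
    (h : Agrees L W (P.modulus^[s.length] (P.c + 5))) : P.labelPrefix L s = P.label W s := by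
  induction s generalizing L W with
  | nil => simpa [labelPrefix, label] using digits_congr (h (P.c + 5) le_rfl).2
  | cons i s ih =>
    rw [List.length_cons, Function.iterate_succ_apply'] at h
    have hd : P.digits (entries L) = P.digits W :=
      digits_congr (h (P.c + 5) (Nat.le_add_right _ _)).2
    -- A descent that has left the tree never re-enters it.
    have hn : s.foldl P.descend none = none := by
      clear ih h
      induction s with
      | nil => rfl
      | cons _ _ ih => simpa [descend] using ih
    cases e : (P.digits W)[i]? with
    | none => simp [labelPrefix, label, descend, hd, e, hn]
    | some d =>
      have := ih (h.child (d := d) hJ hJ')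
      rw [label, e, Option.bind_some, ← this]
      simp [labelPrefix, descend, hd, e]

/-! ### Computability of the splitting algorithm -/

/-- All ingredients of the splitter are computable. -/
structure IsComputable (P : Splitter m) : Prop where
  sel : ∀ d, Computable (P.sel d)
  near : Computable fun p : (ℕ × ℕ) × ℕ => P.near p.1.1 p.1.2 p.2
  J : Computable P.J
  pick : ∀ d, Computable fun p : ℕ × ℕ => P.pick d p.1 p.2

open Computable in
theorem IsComputable.thin (hP : P.IsComputable) :
    Computable fun p : (Fin m × List (List ℕ)) × ℕ => P.thin p.1.1 (entries p.1.2) p.2 := by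
  have sel : Computable₂ P.sel := fin_family hP.sel
  have near : Computable₂ fun (r : (((Fin m × List (List ℕ)) × ℕ) × (ℕ × List ℕ)) × ℕ) i =>
      P.near i r.2 (P.c + 5 + r.1.2.1) :=
    hP.near.comp (g := fun r : ((((Fin m × List (List ℕ)) × ℕ) × (ℕ × List ℕ)) × ℕ) × ℕ =>
        ((r.2, r.1.2), P.c + 5 + r.1.1.2.1))
      (pair (pair snd (snd.comp fst))
        (nat_add.comp (const (P.c + 5)) (fst.comp (snd.comp (fst.comp fst)))))
  have any : Computable₂ fun (r : ((Fin m × List (List ℕ)) × ℕ) × (ℕ × List ℕ)) i' =>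
      r.2.2.any fun i => P.near i i' (P.c + 5 + r.2.1) :=
    list_any (f := fun r : (((Fin m × List (List ℕ)) × ℕ) × (ℕ × List ℕ)) × ℕ => r.1.2.2)
      (snd.comp (snd.comp fst)) near
  have next : Computable fun r : ((Fin m × List (List ℕ)) × ℕ) × (ℕ × List ℕ) =>
      entries r.1.1.2 (P.c + 5 + (r.2.1 + 1)) :=
    computable_entries.comp (g := fun r : ((Fin m × List (List ℕ)) × ℕ) × (ℕ × List ℕ) => r.1.1.2)
      (h := fun r => P.c + 5 + (r.2.1 + 1)) (snd.comp (fst.comp fst))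
      (nat_add.comp (const (P.c + 5)) (succ.comp (fst.comp snd)))
  have first : Computable fun p : (Fin m × List (List ℕ)) × ℕ =>
      (entries p.1.2 (P.c + 5)).filter (P.sel p.1.1) :=
    list_filter (f := fun p : (Fin m × List (List ℕ)) × ℕ => entries p.1.2 (P.c + 5))
      (p := fun (p : (Fin m × List (List ℕ)) × ℕ) i => P.sel p.1.1 i)
      (computable_entries.comp (snd.comp fst) (const (P.c + 5)))
      (sel.comp (fst.comp (fst.comp fst)) snd)
  refine (nat_rec snd first (list_filter next any).to₂).of_eq fun p => ?_
  induction p.2 with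
  | zero => rfl
  | succ j ih => simp only [Splitter.thin, ← ih]

open Computable in
theorem IsComputable.childPrefix (hP : P.IsComputable) : Computable₂ P.childPrefix := by
  have pick : Computable₂ fun (d : Fin m) (p : ℕ × ℕ) => P.pick d p.1 p.2 := fin_family hP.pick
  have thin : Computable fun q : (List (List ℕ) × Fin m) × ℕ =>
      P.thin q.1.2 (entries q.1.1) (P.J q.2) :=
    hP.thin.comp (g := fun q : (List (List ℕ) × Fin m) × ℕ => ((q.1.2, q.1.1), P.J q.2))
      (pair (pair (snd.comp fst) (fst.comp fst)) (hP.J.comp snd))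
  have pick' : Computable₂ fun (q : (List (List ℕ) × Fin m) × ℕ) i => P.pick q.1.2 q.2 i :=
    pick.comp (g := fun q : ((List (List ℕ) × Fin m) × ℕ) × ℕ => q.1.1.2)
      (h := fun q => (q.1.2, q.2)) (snd.comp (fst.comp fst)) (pair (snd.comp fst) snd)
  exact list_map (f := fun p : List (List ℕ) × Fin m => List.range p.1.length)
    (g := fun p n => P.child p.2 (entries p.1) n)
    (Primrec.list_range.to_comp.comp (list_length.comp fst)) (list_map thin pick')

open Computable in
theorem IsComputable.digits (hP : P.IsComputable) :
    Computable fun L : List (List ℕ) => P.digits (entries L) := by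
  have sel : Computable₂ P.sel := fin_family hP.sel
  refine list_filter (p := fun (L : List (List ℕ)) d => (entries L (P.c + 5)).any (P.sel d))
    (const (List.finRange m)) ?_
  exact list_any (f := fun q : List (List ℕ) × Fin m => entries q.1 (P.c + 5))
    (p := fun (q : List (List ℕ) × Fin m) i => P.sel q.2 i)
    (computable_entries.comp fst (const (P.c + 5))) (sel.comp (snd.comp fst) snd)

open Computable in
theorem IsComputable.descend (hP : P.IsComputable) : Computable₂ P.descend := by
  have digit : Computable fun r : (Option (List (List ℕ)) × ℕ) × List (List ℕ) =>
      (P.digits (entries r.2))[r.1.2]? :=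
    list_getElem?.comp (hP.digits.comp snd) (snd.comp fst)
  have child : Computable₂ fun (r : (Option (List (List ℕ)) × ℕ) × List (List ℕ)) d =>
      P.childPrefix r.2 d := hP.childPrefix.comp (snd.comp fst) snd
  exact option_bind (f := fun p : Option (List (List ℕ)) × ℕ => p.1) fst
    (option_map digit child).to₂

open Computable in
theorem IsComputable.labelPrefix (hP : P.IsComputable) : Computable₂ P.labelPrefix := by
  have fold : Computable fun p : List (List ℕ) × List ℕ => p.2.foldl P.descend (some p.1) :=
    list_foldl (h := fun (_ : List (List ℕ) × List ℕ) q => P.descend q.1 q.2) snd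
      (option_some.comp fst) (hP.descend.comp (fst.comp snd) (snd.comp snd)).to₂
  exact option_map fold (hP.digits.comp (g := fun q : (List (List ℕ) × List ℕ) × _ => q.2) snd).to₂

variable (P)

/-- The operator that transforms Cauchy names into names of trees. -/
def operator (l : List ℕ) (n : ℕ) : Option ℕ :=
  bif decide (P.modulus^[(Denumerable.ofNat (List ℕ) n).length] (P.c + 5) < l.length) then
    some (Encodable.encode (P.labelPrefix (l.map decodeIndices) (Denumerable.ofNat (List ℕ) n)))
  else none

variable {P}

open Computable in
theorem IsComputable.operator (hP : P.IsComputable) : Computable₂ P.operator := by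
  have word : Computable fun p : List ℕ × ℕ => Denumerable.ofNat (List ℕ) p.2 :=
    (Computable.ofNat (List ℕ)).comp snd
  refine cond (nat_ltb.comp ?_ (list_length.comp fst)) (option_some.comp (Computable.encode.comp
    (hP.labelPrefix.comp ?_ word))) (const none)
  · exact nat_iterate (h := fun (_ : List ℕ × ℕ) n => P.modulus n) (list_length.comp word)
      (const _) (nat_add.comp (const _) (hP.J.comp snd))
  · exact list_map (g := fun (_ : List ℕ × ℕ) a => decodeIndices a) fst
      (computable_decodeIndices.comp snd)

/-! ### Correctness of the tree -/

variable {X : Type*} [MetricSpace X] {S : ExtendedIFS X (Fin m)} {u : ℕ → X}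
  {K : NonemptyCompacts X}

theorem Correct.label_spec [CompactSpace X] {f : Fin m → X → X} (hP : P.Correct f u)
    (hW : Names u W K) {s : List ℕ} {E : List (Fin m)} (h : P.label W s = some E) :
    E ≠ [] ∧ E.Nodup := by
  induction s generalizing W K with
  | nil =>
    obtain rfl : P.digits W = E := by simpa [label] using h
    exact ⟨hP.digits_ne_nil hW, nodup_digits⟩
  | cons i s ih =>
    cases e : (P.digits W)[i]? with
    | none => simp [label, e] at h
    | some d =>
      obtain ⟨L, hL, -⟩ := hP.exists_split hW
      exact ih (hL d (List.mem_of_getElem? e)) (by simpa [label, e] using h)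

theorem Correct.exists_toHyperDigit [CompactSpace X] {f : Fin m → X → X} (hP : P.Correct f u)
    (hW : Names u W K) {s : List ℕ} {E : List (Fin m)} (h : P.label W s = some E) :
    ∃ e : HyperDigit (Fin m), toHyperDigit E = some e ∧ e.1 = E :=
  ⟨⟨E, hP.label_spec hW h⟩, toHyperDigit_eq_some.2 rfl, rfl⟩

/-- The tree that belongs to a name. -/
def tree [CompactSpace X] (hP : P.Correct S.unary u) (hW : Names u W K) : DTree S.hyper.ar where
  label s := (P.label W s).bind toHyperDigit
  root_mem := by
    obtain ⟨e, he, -⟩ := hP.exists_toHyperDigit hW (s := []) rfl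
    simp [label, he]
  append_mem_iff s i := by
    have h := P.isSome_label_append W s i
    have h₁ : ((P.label W (s ++ [i])).bind toHyperDigit).isSome ↔
        (P.label W (s ++ [i])).isSome := by
      cases e : P.label W (s ++ [i]) with
      | none => simp
      | some E =>
        obtain ⟨d, hd, -⟩ := hP.exists_toHyperDigit hW e
        simp [hd]
    rw [h₁, h]
    constructor
    · rintro ⟨E, e, hi⟩
      obtain ⟨d, hd, rfl⟩ := hP.exists_toHyperDigit hW e
      exact ⟨d, by simp [e, hd], hi⟩
    · rintro ⟨d, hd, hi⟩
      obtain ⟨E, e, hE⟩ := Option.bind_eq_some_iff.1 hd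
      exact ⟨E, e, by rw [← toHyperDigit_eq_some.1 hE]; exact hi⟩

theorem tree_root [CompactSpace X] (hP : P.Correct S.unary u) {T : DTree S.hyper.ar}
    (hW : Names u W K) (hT : ∀ s, T.label s = (P.label W s).bind toHyperDigit) :
    T.root.1 = P.digits W := by
  obtain ⟨e, he, h⟩ := hP.exists_toHyperDigit hW (s := []) rfl
  have : T.label [] = some e := by rw [hT, label, Option.bind_some, he]
  simp [DTree.root, this, h]

/-- Coinduction: the relation between trees and sets given by a common name is a post-fixed point,
because `exists_split` supplies names of the components whose trees are the immediate subtrees. -/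
theorem tree_mem_treeRealisers [CompactSpace X] (hP : P.Correct S.unary u)
    (hW : Names u W K) : (tree hP hW, K) ∈ S.hyper.treeRealisers := by
  let R : Set (DTree S.hyper.ar × NonemptyCompacts X) :=
    {p | ∃ W, Names u W p.2 ∧ ∀ s, p.1.label s = (P.label W s).bind toHyperDigit}
  suffices h : R ⊆ S.hyper.treeRealisers from h ⟨W, hW, fun _ => rfl⟩
  refine OrderHom.le_gfp _ ?_
  rintro ⟨T, K⟩ ⟨W, hW, hT⟩
  dsimp only at hW hT
  have hroot := tree_root hP hW hT
  obtain ⟨L, hL, hK⟩ := hP.exists_split hW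
  have hmem : ∀ κ : Fin T.root.1.length, T.root.1.get κ ∈ P.digits W := fun κ => by
    rw [← hroot]
    exact List.get_mem _ _
  refine ⟨fun κ => L (T.root.1.get κ), ?_, fun κ => ⟨P.child (T.root.1.get κ) W, ?_, ?_⟩⟩
  · apply NonemptyCompacts.ext
    change (K : Set X) = ⋃ κ : Fin T.root.1.length,
      S.unary (T.root.1.get κ) '' (L (T.root.1.get κ) : Set X)
    rw [hK]
    ext x
    simp only [Set.mem_iUnion]
    constructor
    · rintro ⟨d, hd, hx⟩
      rw [← hroot] at hd
      obtain ⟨κ, rfl⟩ := List.get_of_mem hd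
      exact ⟨κ, hx⟩
    · rintro ⟨κ, hx⟩
      exact ⟨_, hmem κ, hx⟩
  · exact hL _ (hmem κ)
  · intro s
    change T.label (κ.1 :: s) = _
    have e : (P.digits W)[κ.1]? = some (T.root.1.get κ) := by
      rw [← hroot]
      exact List.getElem?_eq_getElem _
    rw [hT, label, e, Option.bind_some]

theorem encode_tree_label [CompactSpace X] (hP : P.Correct S.unary u) (hW : Names u W K)
    (s : List ℕ) : Encodable.encode ((tree hP hW).label s) = Encodable.encode (P.label W s) := by
  change Encodable.encode ((P.label W s).bind toHyperDigit) = _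
  cases e : P.label W s with
  | none => rfl
  | some E =>
    obtain ⟨d, hd, h⟩ := hP.exists_toHyperDigit hW e
    rw [Option.bind_some, hd, encode_hyperDigit, h]

theorem computablyTranslates [CompactSpace X] (hc : P.IsComputable) (hP : P.Correct S.unary u) :
    ComputablyTranslates (IsCauchyName (basicSubset u)) S.hyper.IsTreeName := by
  refine ⟨P.operator, hc.operator, fun p K ⟨w, hw, hwd⟩ => ?_⟩
  have hW : Names u (fun n => (w n).1 :: (w n).2) K := fun n => ⟨by simp, hwd n⟩
  refine ⟨(tree hP hW).name, fun n => ?_, tree hP hW, rfl, tree_mem_treeRealisers hP hW⟩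
  -- Above this bound the prefix determines the label; below it the operator gives no answer, so it
  -- never errs.
  have key : ∀ k, P.modulus^[(Denumerable.ofNat (List ℕ) n).length] (P.c + 5) < k →
      P.operator ((List.range k).map p) n = some ((tree hP hW).name n) := by
    intro k hk
    have h : Agrees (((List.range k).map p).map decodeIndices)
        (fun n => (w n).1 :: (w n).2)
        (P.modulus^[(Denumerable.ofNat (List ℕ) n).length] (P.c + 5)) := by
      intro i hi
      have hik : i < k := hi.trans_lt hk
      refine ⟨by simpa using hik, ?_⟩
      rw [entries, List.getD_eq_getElem?_getD]
      simp [hik, hw, decodeIndices_encode]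
    have hl : decide (P.modulus^[(Denumerable.ofNat (List ℕ) n).length] (P.c + 5) <
        ((List.range k).map p).length) = true := by simpa using hk
    rw [operator, hl, cond_true, labelPrefix_eq hP.mono hP.le_J _ h, DTree.name,
      encode_tree_label]
  refine ⟨⟨_, key _ (Nat.lt_succ_self _)⟩, fun k a ha => ?_⟩
  by_cases hk : P.modulus^[(Denumerable.ofNat (List ℕ) n).length] (P.c + 5) < k
  · rw [key k hk, Option.some_inj] at ha
    exact ha.symm
  · simp [operator, hk] at ha

end Splitter

end DigitSpace

namespace DigitSpace

/-! ### Digit spaces with unary digits -/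

namespace ExtendedIFS

section Unary

variable {X D : Type*} [TopologicalSpace X] {S : ExtendedIFS X D} {d : D}

theorem map_eq_unary (h : S.ar d = 1) (y : Fin (S.ar d) → X) :
    S.map d y = S.unary d (y ⟨0, S.ar_pos d⟩) := by
  have : y = fun _ => y ⟨0, S.ar_pos d⟩ := by
    funext κ
    congr 1
    apply Fin.ext
    have := κ.2
    simp only
    omega
  rw [this, unary]

theorem range_unary (h : S.ar d = 1) : Set.range (S.unary d) = Set.range (S.map d) := by
  ext x
  constructor
  · rintro ⟨y, rfl⟩
    exact ⟨_, rfl⟩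
  · rintro ⟨y, rfl⟩
    exact ⟨_, (map_eq_unary h y).symm⟩

end Unary

variable {X : Type*} [MetricSpace X] {m : ℕ} {S : ExtendedIFS X (Fin m)} {u : ℕ → X}

theorem lipschitzWith_unary {q : NNReal} {d : Fin m} (h : LipschitzWith q (S.map d)) :
    LipschitzWith q (S.unary d) := by
  refine LipschitzWith.of_dist_le_mul fun x y => (h.dist_le_mul _ _).trans ?_
  exact mul_le_mul_of_nonneg_left (dist_pi_const_le x y) q.2

theorem IsDigitSpace.exists_lipschitzWith (hS : S.IsDigitSpace) :
    ∃ q : NNReal, q < 1 ∧ ∀ d, LipschitzWith q (S.unary d) := by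
  choose q hq hL using hS.contracting
  refine ⟨Finset.univ.sup q, ?_, fun d =>
    lipschitzWith_unary ((hL d).weaken (Finset.le_sup (Finset.mem_univ d)))⟩
  -- The side condition is `⊥ < 1`, which covers an empty family of digits.
  rw [Finset.sup_lt_iff (by simp)]
  exact fun d _ => hq d

theorem IsWellCovering.exists_lebesgue_number [CompactSpace X] (h : S.IsWellCovering) :
    ∃ c : ℕ, ∀ x, ∃ d, Metric.ball x ((2 : ℝ)⁻¹ ^ c) ⊆ Set.range (S.map d) := by
  obtain ⟨δ, hδ, hL⟩ := lebesgue_number_lemma_of_metric (s := Set.univ)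
    (c := fun d => interior (Set.range (S.map d))) isCompact_univ (fun _ => isOpen_interior)
    fun x _ => Set.mem_iUnion.2 (h x)
  obtain ⟨c, hc⟩ := exists_pow_lt_of_lt_one hδ (by norm_num : (2 : ℝ)⁻¹ < 1)
  refine ⟨c, fun x => ?_⟩
  obtain ⟨d, hd⟩ := hL x trivial
  exact ⟨d, (Metric.ball_subset_ball hc.le).trans (hd.trans interior_subset)⟩

theorem IsDecidable.computablePred (h : S.IsDecidable u) (d : Fin m) (c : ℕ) :
    ComputablePred fun i => Metric.ball (u i) ((2 : ℝ)⁻¹ ^ c) ⊆ Set.range (S.map d) := by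
  classical
  obtain ⟨_, hc⟩ := h d
  refine ⟨fun _ => inferInstance,
    (hc.comp (Computable.id.pair (Computable.const (dyadic c)))).of_eq fun i => ?_⟩
  simp [posRat_dyadic]

/-- For a decidable well-covering computable digit space with approximable choice there is a
computable splitter. -/
theorem IsComputableDigitSpace.exists_splitter (hS : S.IsComputableDigitSpace u)
    (hcov : S.IsWellCovering) (hdec : S.IsDecidable u) (hchoice : S.HasApproximableChoice u)
    (hunary : ∀ d, S.ar d = 1) :
    ∃ P : Splitter m, P.IsComputable ∧ P.Correct S.unary u := by
  classical
  have := hS.digitSpace.compact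
  obtain ⟨c, hc⟩ := hcov.exists_lebesgue_number
  obtain ⟨near, hnear, hnear'⟩ := hS.metric.exists_near
  obtain ⟨q, hq, hL⟩ := hS.digitSpace.exists_lipschitzWith
  choose v hv hdom htheta hη hspec using hchoice
  choose η hηc hη using hη
  have hsel : ∀ d, ∃ s : ℕ → Bool, Computable s ∧
      ∀ i, s i = true ↔ Metric.ball (u i) ((2 : ℝ)⁻¹ ^ c) ⊆ Set.range (S.map d) := fun d => by
    obtain ⟨_, h⟩ := hdec.computablePred d c
    exact ⟨_, h, fun i => by simp⟩
  choose sel hsel hsel' using hsel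
  have hint : ∀ d i, Metric.ball (u i) ((2 : ℝ)⁻¹ ^ (c + 1)) ⊆ Set.range (S.map d) →
      u i ∈ interior (Set.range (S.map d)) := fun d i h =>
    mem_interior.2 ⟨_, h, Metric.isOpen_ball, Metric.mem_ball_self (inv_two_pow_pos _)⟩
  -- Membership in the interior need not be decidable, but containing a fixed ball is, and it
  -- ensures that the choice procedure is defined; so the procedure can be replaced by a total one.
  have hg : ∀ d, ∃ g : (ℕ × ℕ) × ℕ → (Fin (S.ar d) → ℕ), Computable g ∧
      ∀ p, Metric.ball (u p.2) ((2 : ℝ)⁻¹ ^ (c + 1)) ⊆ Set.range (S.map d) → g p ∈ v d p := by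
    intro d
    refine Computable.exists_total (f := v d) (p := fun p : (ℕ × ℕ) × ℕ =>
      Metric.ball (u p.2) ((2 : ℝ)⁻¹ ^ (c + 1)) ⊆ Set.range (S.map d)) (hv d) ?_
      fun p hp => hdom d p.1 p.2 (hint d _ hp)
    obtain ⟨inst, h⟩ := hdec.computablePred d (c + 1)
    exact ⟨fun p => inferInstance, (h.comp Computable.snd).of_eq fun p => rfl⟩
  choose g hg hgv using hg
  obtain ⟨J, hJ, hJm, hJη⟩ := Computable.exists_monotone_bound
    (f := fun d n => (η d (dyadic (n + 3))).2)
    fun d => Computable.snd.comp ((hηc d).comp (computable_dyadic.comp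
      (Computable.nat_add.comp Computable.id (Computable.const 3))))
  -- The summand `n` ensures `le_J`; precision `n + 3` is what makes the steps of the children
  -- summable to `2⁻⁽ⁿ⁺¹⁾`.
  refine ⟨⟨c, sel, fun i j k => near ((i, j), k), fun n => J n + n,
    fun d n i => g d (dyadic (n + 3), i) ⟨0, S.ar_pos d⟩⟩, ⟨hsel, hnear, ?_, fun d => ?_⟩, ?_⟩
  · exact Computable.nat_add.comp hJ Computable.id
  · have h₁ : Computable fun p : ℕ × ℕ => g d (dyadic (p.1 + 3), p.2) :=
      (hg d).comp ((computable_dyadic.comp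
        (Computable.nat_add.comp Computable.fst (Computable.const 3))).pair Computable.snd)
    exact Computable.fin_app.comp h₁ (Computable.const (⟨0, S.ar_pos d⟩ : Fin (S.ar d)))
  · have hr : ∀ d, Set.range (S.unary d) = Set.range (S.map d) := fun d => range_unary (hunary d)
    constructor
    · simpa only [hr] using hc
    · simpa only [hr] using hsel'
    · exact fun i j k => (hnear' i j k).1
    · exact fun i j k => (hnear' i j k).2
    · exact fun a b h => Nat.add_le_add (hJm h) h
    · exact fun n => Nat.le_add_left _ _
    · intro d n i j hi hj hd
      rw [hr] at hi hj
      have h := hη d (dyadic (n + 3)) i j (hint d i hi) (hint d j hj)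
        (hd.trans_le ((inv_two_pow_anti ((hJη d n).trans (Nat.le_add_right _ _))).trans
          (inv_two_pow_le_posRat _))) _ (hgv d (_, i) hi) _ (hgv d (_, j) hj)
      rw [posRat_dyadic] at h
      exact (dist_le_pi_dist _ _ (⟨0, S.ar_pos d⟩ : Fin (S.ar d))).trans_lt h
    · intro d n i hi
      rw [hr] at hi
      have h := htheta d (dyadic (n + 3)) (dyadic (n + 1 + 3)) i (hint d i hi) _
        (hgv d (_, i) hi) _ (hgv d (_, i) hi)
      rw [posRat_dyadic, posRat_dyadic, max_eq_left (inv_two_pow_anti (by omega))] at h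
      exact (dist_le_pi_dist _ _ (⟨0, S.ar_pos d⟩ : Fin (S.ar d))).trans_lt h
    · intro d n i hi
      rw [hr] at hi
      obtain ⟨y, hy, h⟩ := hspec d (dyadic (n + 3)) i (hint d i hi) _ (hgv d (_, i) hi)
      rw [posRat_dyadic] at h
      exact ⟨y ⟨0, S.ar_pos d⟩, by rw [← map_eq_unary (hunary d), hy],
        (dist_le_pi_dist _ _ (⟨0, S.ar_pos d⟩ : Fin (S.ar d))).trans_lt h⟩
    · exact fun d => (hL d).weaken hq.le

end ExtendedIFS

end DigitSpace

namespace DigitSpace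

/-! ### From trees to Cauchy names -/

section Frontier

variable {m : ℕ}

/-- The digits in the label with the code `a`. -/
def decodeLabel (m a : ℕ) : List (Fin m) :=
  ((Encodable.decode a : Option (Option (List (Fin m)))).bind id).getD []

theorem computable_decodeLabel : Computable (decodeLabel m) :=
  Computable.option_getD
    (Computable.option_bind Computable.decode (Computable.snd (α := ℕ)).to₂)
    (Computable.const [])

theorem decodeLabel_encode (o : Option (HyperDigit (Fin m))) :
    decodeLabel m (Encodable.encode o) = (o.map fun e => e.1).getD [] := by
  have h : Encodable.encode o = Encodable.encode (o.map fun e => e.1) := by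
    cases o <;> rfl
  rw [decodeLabel, h, Encodable.encodek]
  rfl

/-- The children of a node, given by its word and the digits on the way to it (the last one
first). -/
def expand (lab : List ℕ → List (Fin m)) (x : List ℕ × List (Fin m)) :
    List (List ℕ × List (Fin m)) :=
  (List.range (lab x.1).length).flatMap fun i =>
    (((lab x.1)[i]?).map fun d => [(x.1 ++ [i], d :: x.2)]).getD []

theorem mem_expand {lab : List ℕ → List (Fin m)} {x y : List ℕ × List (Fin m)} :
    y ∈ expand lab x ↔ ∃ i d, (lab x.1)[i]? = some d ∧ y = (x.1 ++ [i], d :: x.2) := by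
  simp only [expand, List.mem_flatMap, List.mem_range]
  constructor
  · rintro ⟨i, hi, h⟩
    rw [List.getElem?_eq_getElem hi] at h
    exact ⟨i, _, List.getElem?_eq_getElem hi, by simpa using h⟩
  · rintro ⟨i, d, h, rfl⟩
    exact ⟨i, (List.getElem?_eq_some_iff.1 h).1, by simp [h]⟩

/-- The children of all nodes in a list. -/
def nextLevel (lab : List ℕ → List (Fin m)) (L : List (List ℕ × List (Fin m))) :
    List (List ℕ × List (Fin m)) :=
  L.flatMap (expand lab)

/-- The labels in a tree with the name `p`. -/
def labelOf (m : ℕ) (p : ℕ → ℕ) (s : List ℕ) : List (Fin m) :=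
  decodeLabel m (p (Encodable.encode s))

/-- The version of `nextLevel` for a prefix of the name of the tree. -/
def nextLevelPrefix (l : List ℕ) (o : Option (List (List ℕ × List (Fin m)))) :
    Option (List (List ℕ × List (Fin m))) :=
  -- Every label needed must lie within the prefix, so the default `0` used for look-up is never
  -- read at a node of `L`.
  o.bind fun L => bif L.all fun x => decide (Encodable.encode x.1 < l.length) then
    some (nextLevel (labelOf m fun i => l.getD i 0) L) else none

theorem nextLevel_congr {lab lab' : List ℕ → List (Fin m)} {L : List (List ℕ × List (Fin m))}
    (h : ∀ x ∈ L, lab x.1 = lab' x.1) : nextLevel lab L = nextLevel lab' L := by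
  refine List.flatMap_congr fun x hx => ?_
  simp only [expand, h x hx]

theorem nextLevelPrefix_eq {p : ℕ → ℕ} {k : ℕ} {L : List (List ℕ × List (Fin m))}
    (h : ∀ x ∈ L, Encodable.encode x.1 < k) :
    nextLevelPrefix ((List.range k).map p) (some L) = some (nextLevel (labelOf m p) L) := by
  have h₁ : (L.all fun x =>
      decide (Encodable.encode x.1 < ((List.range k).map p).length)) = true := by
    simpa using h
  rw [nextLevelPrefix, Option.bind_some, h₁, cond_true, Option.some_inj]
  refine nextLevel_congr fun x hx => ?_
  rw [labelOf, labelOf, List.getD_eq_getElem?_getD]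
  simp [h x hx]

theorem nextLevelPrefix_iterate_sound {p : ℕ → ℕ} {k j : ℕ}
    {L₀ L : List (List ℕ × List (Fin m))}
    (h : (nextLevelPrefix ((List.range k).map p))^[j] (some L₀) = some L) :
    L = (nextLevel (labelOf m p))^[j] L₀ := by
  induction j generalizing L with
  | zero => simpa using h.symm
  | succ j ih =>
    rw [Function.iterate_succ_apply'] at h ⊢
    cases e : (nextLevelPrefix ((List.range k).map p))^[j] (some L₀) with
    | none => simp [e, nextLevelPrefix] at h
    | some L' =>
      rw [e] at h
      by_cases hk : ∀ x ∈ L', Encodable.encode x.1 < k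
      · rw [nextLevelPrefix_eq hk, Option.some_inj] at h
        rw [← h, ih e]
      · have : (L'.all fun x =>
            decide (Encodable.encode x.1 < ((List.range k).map p).length)) = false := by
          rw [Bool.eq_false_iff]
          simpa using hk
        rw [nextLevelPrefix, Option.bind_some, this] at h
        simp at h

theorem exists_nextLevelPrefix_iterate_eq (p : ℕ → ℕ) (j : ℕ)
    (L₀ : List (List ℕ × List (Fin m))) :
    ∃ k₀, ∀ k ≥ k₀, (nextLevelPrefix ((List.range k).map p))^[j] (some L₀) =
      some ((nextLevel (labelOf m p))^[j] L₀) := by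
  induction j with
  | zero => exact ⟨0, fun _ _ => rfl⟩
  | succ j ih =>
    obtain ⟨k₀, hk₀⟩ := ih
    set L := (nextLevel (labelOf m p))^[j] L₀
    -- The sum is a crude upper bound for the codes of the finitely many nodes of the level.
    refine ⟨k₀ + ((L.map fun x => Encodable.encode x.1).sum + 1), fun k hk => ?_⟩
    rw [Function.iterate_succ_apply', Function.iterate_succ_apply', hk₀ k (by omega)]
    refine nextLevelPrefix_eq fun x hx => ?_
    have : Encodable.encode x.1 ≤ (L.map fun x => Encodable.encode x.1).sum :=
      List.le_sum_of_mem (List.mem_map_of_mem hx)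
    omega

theorem mem_nextLevel_iterate {lab : List ℕ → List (Fin m)} {k : ℕ}
    {L : List (List ℕ × List (Fin m))} {y : List ℕ × List (Fin m)} :
    y ∈ (nextLevel lab)^[k] L ↔ ∃ x ∈ L, y ∈ (nextLevel lab)^[k] [x] := by
  induction k generalizing y with
  | zero => simp
  | succ k ih =>
    simp only [Function.iterate_succ_apply', nextLevel, List.mem_flatMap]
    constructor
    · rintro ⟨b, hb, hy⟩
      obtain ⟨x, hx, hb⟩ := ih.1 hb
      exact ⟨x, hx, b, hb, hy⟩
    · rintro ⟨x, hx, b, hb, hy⟩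
      exact ⟨b, ih.2 ⟨x, hx, hb⟩, hy⟩

/-- The iteration adds levels at the bottom, whereas realisers unfold at the root; this peels off
the root. -/
theorem mem_nextLevel_iterate_succ {lab : List ℕ → List (Fin m)} {k : ℕ}
    {r : List ℕ} {ds : List (Fin m)} {y : List ℕ × List (Fin m)} :
    y ∈ (nextLevel lab)^[k + 1] [(r, ds)] ↔ ∃ i d, (lab r)[i]? = some d ∧
      y ∈ (nextLevel lab)^[k] [(r ++ [i], d :: ds)] := by
  rw [Function.iterate_succ_apply, mem_nextLevel_iterate]
  have : nextLevel lab [(r, ds)] = expand lab (r, ds) := by simp [nextLevel]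
  rw [this]
  constructor
  · rintro ⟨x, hx, hy⟩
    obtain ⟨i, d, h, rfl⟩ := mem_expand.1 hx
    exact ⟨i, d, h, hy⟩
  · rintro ⟨i, d, h, hy⟩
    exact ⟨_, mem_expand.2 ⟨i, d, h, rfl⟩, hy⟩

theorem length_of_mem_nextLevel_iterate {lab : List ℕ → List (Fin m)} {k : ℕ}
    {r : List ℕ} {ds : List (Fin m)} {y : List ℕ × List (Fin m)}
    (h : y ∈ (nextLevel lab)^[k] [(r, ds)]) : y.2.length = ds.length + k := by
  induction k generalizing r ds with
  | zero =>
    obtain rfl : y = (r, ds) := by simpa using h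
    rfl
  | succ k ih =>
    obtain ⟨i, d, -, hy⟩ := mem_nextLevel_iterate_succ.1 h
    rw [ih hy, List.length_cons]
    omega

/-- The index of the approximation with precision `p` of the image of the basic element with index
`0` under the composition of the digits in the list, the first of which is applied first. -/
def approximate (g : Fin m → ℕ → ℕ → ℕ) (p : ℕ) (ds : List (Fin m)) (i : ℕ) : ℕ :=
  ds.foldl (fun i d => g d i p) i

/-- The `n`-th member of the Cauchy name, computed from the level `k n` of the tree with the
precision `n + 2 + k n`. -/
def levelApproximation (g : Fin m → ℕ → ℕ → ℕ) (k : ℕ → ℕ) (n : ℕ)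
    (L : List (List ℕ × List (Fin m))) : List ℕ :=
  L.map fun y => approximate g (n + 2 + k n) y.2 0

/-- The operator that transforms names of trees into Cauchy names. -/
def treeOperator (g : Fin m → ℕ → ℕ → ℕ) (k : ℕ → ℕ) (l : List ℕ) (n : ℕ) : Option ℕ :=
  ((nextLevelPrefix l)^[k n] (some [([], [])])).map fun L =>
    Encodable.encode ((levelApproximation g k n L).headI, (levelApproximation g k n L).tail)

/-! ### Computability -/

open Computable in
theorem computable_labelOf_getD :
    Computable fun p : List ℕ × List ℕ => labelOf m (fun i => p.1.getD i 0) p.2 :=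
  computable_decodeLabel.comp ((list_getD 0).comp fst (Computable.encode.comp snd))

open Computable in
theorem computable_nextLevel_getD :
    Computable₂ fun (l : List ℕ) (L : List (List ℕ × List (Fin m))) =>
      nextLevel (labelOf m fun i => l.getD i 0) L := by
  have lab : Computable fun q : (List ℕ × List (List ℕ × List (Fin m))) × (List ℕ × List (Fin m)) =>
      labelOf m (fun i => q.1.1.getD i 0) q.2.1 :=
    computable_labelOf_getD.comp
      (g := fun q : (List ℕ × List (List ℕ × List (Fin m))) × (List ℕ × List (Fin m)) =>
        (q.1.1, q.2.1)) (pair (fst.comp fst) (fst.comp snd))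
  have node : Computable₂ fun (r : ((List ℕ × List (List ℕ × List (Fin m))) ×
      (List ℕ × List (Fin m))) × ℕ) (d : Fin m) => [(r.1.2.1 ++ [r.2], d :: r.1.2.2)] := by
    have h₁ : Computable fun q : (((List ℕ × List (List ℕ × List (Fin m))) ×
        (List ℕ × List (Fin m))) × ℕ) × Fin m => q.1.1.2.1 ++ [q.1.2] :=
      list_concat.comp (fst.comp (snd.comp (fst.comp fst))) (snd.comp fst)
    have h₂ : Computable fun q : (((List ℕ × List (List ℕ × List (Fin m))) ×
        (List ℕ × List (Fin m))) × ℕ) × Fin m => q.2 :: q.1.1.2.2 :=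
      list_cons.comp snd (snd.comp (snd.comp (fst.comp fst)))
    exact list_cons.comp (h₁.pair h₂) (const [])
  have child : Computable₂ fun (q : (List ℕ × List (List ℕ × List (Fin m))) ×
      (List ℕ × List (Fin m))) (i : ℕ) =>
      (((labelOf m (fun i => q.1.1.getD i 0) q.2.1)[i]?).map
        fun d => [(q.2.1 ++ [i], d :: q.2.2)]).getD [] :=
    option_getD (option_map (list_getElem?.comp (lab.comp fst) snd) node) (const [])
  exact list_flatMap snd
    (list_flatMap (Primrec.list_range.to_comp.comp (list_length.comp lab)) child).to₂

open Computable in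
theorem computable_nextLevelPrefix : Computable₂ (nextLevelPrefix (m := m)) := by
  have test : Computable fun q : (List ℕ × Option (List (List ℕ × List (Fin m)))) ×
      List (List ℕ × List (Fin m)) =>
      q.2.all fun x => decide (Encodable.encode x.1 < q.1.1.length) :=
    list_all snd (nat_ltb.comp (Computable.encode.comp (fst.comp snd))
      (list_length.comp (fst.comp (fst.comp fst)))).to₂
  have step : Computable fun q : (List ℕ × Option (List (List ℕ × List (Fin m)))) ×
      List (List ℕ × List (Fin m)) => nextLevel (labelOf m fun i => q.1.1.getD i 0) q.2 :=
    computable_nextLevel_getD.comp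
      (g := fun q : (List ℕ × Option (List (List ℕ × List (Fin m)))) ×
        List (List ℕ × List (Fin m)) => q.1.1) (fst.comp fst) snd
  exact option_bind snd (cond test (option_some.comp step) (const none)).to₂

open Computable in
theorem computable_treeOperator {g : Fin m → ℕ → ℕ → ℕ} {k : ℕ → ℕ}
    (hg : ∀ d, Computable fun p : ℕ × ℕ => g d p.1 p.2) (hk : Computable k) :
    Computable₂ (treeOperator g k) := by
  have hg' : Computable₂ fun d (p : ℕ × ℕ) => g d p.1 p.2 := fin_family hg
  have precision : Computable fun n => n + 2 + k n :=
    nat_add.comp (nat_add.comp Computable.id (const 2)) hk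
  have approx : Computable fun q : ℕ × List (Fin m) => approximate g (q.1 + 2 + k q.1) q.2 0 :=
    list_foldl (h := fun (q : ℕ × List (Fin m)) (r : ℕ × Fin m) => g r.2 r.1 (q.1 + 2 + k q.1))
      snd (const 0) (hg'.comp (g := fun t : (ℕ × List (Fin m)) × (ℕ × Fin m) => t.2.2)
        (h := fun t => (t.2.1, t.1.1 + 2 + k t.1.1)) (snd.comp snd)
        (pair (fst.comp snd) (precision.comp (fst.comp fst))))
  have level : Computable₂ (levelApproximation g k) :=
    list_map (f := fun q : ℕ × List (List ℕ × List (Fin m)) => q.2)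
      (g := fun q y => approximate g (q.1 + 2 + k q.1) y.2 0) snd
      (approx.comp (g := fun t : (ℕ × List (List ℕ × List (Fin m))) × (List ℕ × List (Fin m)) =>
        (t.1.1, t.2.2)) (pair (fst.comp fst) (snd.comp snd)))
  have iter : Computable fun p : List ℕ × ℕ =>
      (nextLevelPrefix (m := m) p.1)^[k p.2] (some [([], [])]) :=
    nat_iterate (h := fun p : List ℕ × ℕ => nextLevelPrefix (m := m) p.1) (hk.comp snd)
      (const (some [([], [])])) (computable_nextLevelPrefix.comp (fst.comp fst) snd)
  have level' : Computable fun q : (List ℕ × ℕ) × List (List ℕ × List (Fin m)) =>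
      levelApproximation g k q.1.2 q.2 :=
    level.comp (g := fun q : (List ℕ × ℕ) × List (List ℕ × List (Fin m)) => q.1.2)
      (snd.comp fst) snd
  exact option_map iter (Computable.encode.comp
    ((Primrec.list_headI.to_comp.comp level').pair (Primrec.list_tail.to_comp.comp level'))).to₂

end Frontier

/-! ### Correctness of the approximations -/

section Metric

variable {X : Type*} [MetricSpace X] {m : ℕ} {S : ExtendedIFS X (Fin m)} {u : ℕ → X}
  {K : NonemptyCompacts X}

/-- The composition of the digits in a list, the first of which is applied first. -/
def ExtendedIFS.compose (S : ExtendedIFS X (Fin m)) (ds : List (Fin m)) (x : X) : X :=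
  ds.foldl (fun x d => S.unary d x) x

theorem ExtendedIFS.dist_compose_le {q : NNReal} (hq : ∀ d, LipschitzWith q (S.unary d))
    (ds : List (Fin m)) (x y : X) :
    dist (S.compose ds x) (S.compose ds y) ≤ (q : ℝ) ^ ds.length * dist x y := by
  induction ds generalizing x y with
  | nil => simp [compose]
  | cons d ds ih =>
    refine (ih (S.unary d x) (S.unary d y)).trans ?_
    rw [List.length_cons, pow_succ, mul_assoc]
    exact mul_le_mul_of_nonneg_left ((hq d).dist_le_mul x y) (by positivity)

/-- Each digit contributes one rounding error, and the digits applied afterwards do not enlarge it,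
so the errors merely add up. -/
theorem ExtendedIFS.dist_compose_approximate_le {q : NNReal} (hq1 : q ≤ 1)
    (hq : ∀ d, LipschitzWith q (S.unary d)) {g : Fin m → ℕ → ℕ → ℕ}
    (hg : ∀ d i p, dist (S.unary d (u i)) (u (g d i p)) < (2 : ℝ)⁻¹ ^ p) (p : ℕ)
    (ds : List (Fin m)) (i : ℕ) :
    dist (S.compose ds (u i)) (u (approximate g p ds i)) ≤ ds.length * (2 : ℝ)⁻¹ ^ p := by
  induction ds generalizing i with
  | nil => simp [compose, approximate]
  | cons d ds ih =>
    have h₁ := ExtendedIFS.dist_compose_le hq ds (S.unary d (u i)) (u (g d i p))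
    have h₂ : (q : ℝ) ^ ds.length ≤ 1 := pow_le_one₀ q.2 hq1
    have h₃ := mul_le_of_le_one_left (dist_nonneg (x := S.unary d (u i)) (y := u (g d i p))) h₂
    have h₄ := dist_triangle (S.compose ds (S.unary d (u i))) (S.compose ds (u (g d i p)))
      (u (approximate g p ds (g d i p)))
    have h₅ := ih (g d i p)
    have h₆ := hg d i p
    change dist (S.compose ds (S.unary d (u i))) (u (approximate g p ds (g d i p))) ≤ _
    push_cast [List.length_cons]
    linarith

theorem exists_of_mem_treeRealisers {T : DTree S.hyper.ar} (h : (T, K) ∈ S.hyper.treeRealisers) :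
    ∃ L : Fin T.root.1.length → NonemptyCompacts X,
      (∀ x, x ∈ K ↔ ∃ κ, ∃ y ∈ L κ, S.unary (T.root.1.get κ) y = x) ∧
      ∀ κ, (T.subtree κ, L κ) ∈ S.hyper.treeRealisers := by
  unfold ExtendedIFS.treeRealisers at h
  rw [← OrderHom.map_gfp] at h
  obtain ⟨L, hK, hL⟩ := h
  refine ⟨L, fun x => ?_, hL⟩
  dsimp only at hK
  rw [hK]
  change x ∈ (⋃ κ : Fin T.root.1.length, S.unary (T.root.1.get κ) '' (L κ : Set X)) ↔ _
  simp only [Set.mem_iUnion]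
  rfl

/-- Induction on the depth, for a subtree `T` sitting at the word `r` of a larger labelling, with
`ds` the digits above it. Only the existence of some `z` is asserted, since the image of the whole
space under a long composition is small anyway. -/
theorem compose_frontier (k : ℕ) {T : DTree S.hyper.ar} (h : (T, K) ∈ S.hyper.treeRealisers)
    {lab : List ℕ → List (Fin m)} {r : List ℕ} (ds : List (Fin m))
    (hlab : ∀ s, lab (r ++ s) = ((T.label s).map fun e => e.1).getD []) :
    (∀ x ∈ K, ∃ y ∈ (nextLevel lab)^[k] [(r, ds)], ∃ z, S.compose ds x = S.compose y.2 z) ∧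
    ∀ y ∈ (nextLevel lab)^[k] [(r, ds)], ∃ x ∈ K, ∃ z, S.compose ds x = S.compose y.2 z := by
  induction k generalizing T K r ds with
  | zero =>
    simp only [Function.iterate_zero, id, List.mem_singleton]
    obtain ⟨x₀, hx₀⟩ := K.nonempty
    exact ⟨fun x _ => ⟨_, rfl, x, rfl⟩, fun y hy => ⟨x₀, hx₀, x₀, by rw [hy]⟩⟩
  | succ k ih =>
    obtain ⟨L, hK, hL⟩ := exists_of_mem_treeRealisers h
    have hroot : lab r = T.root.1 := by
      have : T.label [] = some T.root := by simp [DTree.root]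
      have h₀ := hlab []
      rwa [List.append_nil, this] at h₀
    have hsub : ∀ (κ : Fin T.root.1.length) s, lab (r ++ [κ.1] ++ s) =
        (((T.subtree κ).label s).map fun e => e.1).getD [] := fun κ s => by
      rw [List.append_assoc]
      exact hlab (κ.1 :: s)
    constructor
    · intro x hx
      obtain ⟨κ, y, hy, rfl⟩ := (hK x).1 hx
      obtain ⟨w, hw, z, hz⟩ := (ih (hL κ) (T.root.1.get κ :: ds) (hsub κ)).1 y hy
      refine ⟨w, mem_nextLevel_iterate_succ.2 ⟨κ.1, T.root.1.get κ, ?_, hw⟩, z, hz⟩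
      rw [hroot]
      exact List.getElem?_eq_getElem _
    · intro w hw
      obtain ⟨i, d, hd, hw⟩ := mem_nextLevel_iterate_succ.1 hw
      rw [hroot] at hd
      obtain ⟨hi, rfl⟩ := List.getElem?_eq_some_iff.1 hd
      obtain ⟨y, hy, z, hz⟩ := (ih (hL ⟨i, hi⟩) (T.root.1.get ⟨i, hi⟩ :: ds)
        (hsub ⟨i, hi⟩)).2 w hw
      exact ⟨_, (hK _).2 ⟨⟨i, hi⟩, y, hy, rfl⟩, z, hz⟩

theorem labelOf_name (T : DTree S.hyper.ar) (s : List ℕ) :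
    labelOf m T.name s = ((T.label s).map fun e => e.1).getD [] := by
  rw [labelOf, DTree.name, Denumerable.ofNat_encode]
  exact decodeLabel_encode _

theorem dist_levelApproximation_lt {q : NNReal} (hq1 : q ≤ 1)
    (hq : ∀ d, LipschitzWith q (S.unary d)) {g : Fin m → ℕ → ℕ → ℕ}
    (hg : ∀ d i p, dist (S.unary d (u i)) (u (g d i p)) < (2 : ℝ)⁻¹ ^ p) {k : ℕ → ℕ} {n : ℕ}
    (hk : ∀ x y : X, (q : ℝ) ^ k n * dist x y ≤ (2 : ℝ)⁻¹ ^ (n + 2))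
    {T : DTree S.hyper.ar} (h : (T, K) ∈ S.hyper.treeRealisers) :
    dist K (finiteSet u (levelApproximation g k n
      ((nextLevel (labelOf m T.name))^[k n] [([], [])]))) < (2 : ℝ)⁻¹ ^ n := by
  obtain ⟨h₁, h₂⟩ := compose_frontier (k n) h (lab := labelOf m T.name) (r := []) []
    fun s => labelOf_name T s
  set L := (nextLevel (labelOf m T.name))^[k n] [([], [])]
  -- Contraction replaces `z` by `u 0` at cost `2⁻⁽ⁿ⁺²⁾`. The `k n` rounding errors `2⁻⁽ⁿ⁺²⁺ᵏ⁾` cost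
  -- at most as much again, since `k ≤ 2ᵏ`.
  have key : ∀ y ∈ L, ∀ z, dist (S.compose y.2 z)
      (u (approximate g (n + 2 + k n) y.2 0)) ≤ (2 : ℝ)⁻¹ ^ (n + 1) := by
    intro y hy z
    have hlen : y.2.length = k n := by
      have := length_of_mem_nextLevel_iterate hy
      simpa using this
    have a := ExtendedIFS.dist_compose_le hq y.2 z (u 0)
    have b := ExtendedIFS.dist_compose_approximate_le hq1 hq hg (n + 2 + k n) y.2 0
    rw [hlen] at a b
    have c := hk z (u 0)
    have d : (k n : ℝ) * (2 : ℝ)⁻¹ ^ (n + 2 + k n) ≤ (2 : ℝ)⁻¹ ^ (n + 2) := by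
      have e : (k n : ℝ) * (2 : ℝ)⁻¹ ^ k n ≤ 1 := by
        rw [inv_pow, ← div_eq_mul_inv, div_le_one (by positivity)]
        exact_mod_cast (Nat.lt_two_pow_self (n := k n)).le
      rw [pow_add, mul_left_comm]
      exact mul_le_of_le_one_right (inv_two_pow_pos _).le e
    have f : (2 : ℝ)⁻¹ ^ (n + 1) = (2 : ℝ)⁻¹ ^ (n + 2) + (2 : ℝ)⁻¹ ^ (n + 2) := by ring
    rw [f]
    linarith [dist_triangle (S.compose y.2 z) (S.compose y.2 (u 0))
      (u (approximate g (n + 2 + k n) y.2 0))]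
  have hne : levelApproximation g k n L ≠ [] := by
    obtain ⟨x, hx⟩ := K.nonempty
    obtain ⟨y, hy, -⟩ := h₁ x hx
    simpa [levelApproximation] using List.ne_nil_of_mem hy
  refine (dist_le_of_forall_exists (inv_two_pow_pos (n + 1)).le (fun x hx => ?_)
    fun y hy => ?_).trans_lt (show (2 : ℝ)⁻¹ ^ (n + 1) < (2 : ℝ)⁻¹ ^ n by
      rw [inv_two_pow_succ]; linarith [inv_two_pow_pos n])
  · obtain ⟨y, hy, z, hz⟩ := h₁ x hx
    refine ⟨_, (mem_finiteSet hne).2 ⟨_, List.mem_map_of_mem hy, rfl⟩, ?_⟩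
    have : x = S.compose y.2 z := hz
    rw [this]
    exact key y hy z
  · obtain ⟨i, hi, rfl⟩ := (mem_finiteSet hne).1 hy
    obtain ⟨y, hyL, rfl⟩ := List.mem_map.1 hi
    obtain ⟨x, hx, z, hz⟩ := h₂ y hyL
    have : x = S.compose y.2 z := hz
    exact ⟨x, hx, by rw [this]; exact key y hyL z⟩

/-- A computable depth at which the pieces of a digit space have diameter at most `2⁻ⁿ⁻²`. -/
theorem exists_computable_depth [CompactSpace X] {q : NNReal} (hq1 : q < 1) :
    ∃ k : ℕ → ℕ, Computable k ∧
      ∀ n, ∀ x y : X, (q : ℝ) ^ k n * dist x y ≤ (2 : ℝ)⁻¹ ^ (n + 2) := by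
  obtain ⟨e, he⟩ := exists_pow_lt_of_lt_one (by norm_num : (0 : ℝ) < (2 : ℝ)⁻¹)
    (show (q : ℝ) < 1 from hq1)
  obtain ⟨a, ha⟩ := pow_unbounded_of_one_lt (Metric.diam (Set.univ : Set X))
    (one_lt_two : (1 : ℝ) < 2)
  -- Every `e` levels halve the diameter, as `qᵉ < 1/2`; the summand `a` absorbs the initial
  -- diameter, which is below `2ᵃ`.
  refine ⟨fun n => e * (n + 2 + a), Computable.nat_mul.comp (Computable.const e)
    (Computable.nat_add.comp (Computable.nat_add.comp Computable.id (Computable.const 2))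
      (Computable.const a)), fun n x y => ?_⟩
  have h₁ : dist x y ≤ 2 ^ a := (Metric.dist_le_diam_of_mem isCompact_univ.isBounded
    (Set.mem_univ x) (Set.mem_univ y)).trans ha.le
  have h₂ : (q : ℝ) ^ (e * (n + 2 + a)) ≤ (2 : ℝ)⁻¹ ^ (n + 2 + a) := by
    rw [pow_mul]
    exact pow_le_pow_left₀ (by positivity) he.le _
  calc (q : ℝ) ^ (e * (n + 2 + a)) * dist x y ≤ (2 : ℝ)⁻¹ ^ (n + 2 + a) * 2 ^ a :=
        mul_le_mul h₂ h₁ dist_nonneg (by positivity)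
    _ = (2 : ℝ)⁻¹ ^ (n + 2) := by
        rw [pow_add _ (n + 2), mul_assoc, ← mul_pow]
        simp

theorem ExtendedIFS.IsComputableDigitSpace.exists_approximation
    (hS : S.IsComputableDigitSpace u) :
    ∃ g : Fin m → ℕ → ℕ → ℕ, (∀ d, Computable fun p : ℕ × ℕ => g d p.1 p.2) ∧
      ∀ d i p, dist (S.unary d (u i)) (u (g d i p)) < (2 : ℝ)⁻¹ ^ p := by
  choose G hG hGd using fun d => (hS.digits d).2
  refine ⟨fun d i p => G d (fun _ => i, p), fun d => (hG d).comp
    (Computable.pair ?_ Computable.snd), fun d i p => hGd d (fun _ => i) p⟩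
  exact (Primrec.fin_curry.2 (Primrec.fst.comp Primrec.fst).to₂).to_comp

theorem ExtendedIFS.IsComputableDigitSpace.computablyTranslates_tree
    (hS : S.IsComputableDigitSpace u) :
    ComputablyTranslates S.hyper.IsTreeName (IsCauchyName (basicSubset u)) := by
  have := hS.digitSpace.compact
  obtain ⟨q, hq1, hq⟩ := hS.digitSpace.exists_lipschitzWith
  obtain ⟨g, hgc, hg⟩ := hS.exists_approximation
  obtain ⟨k, hkc, hk⟩ := exists_computable_depth (X := X) hq1
  refine ⟨treeOperator g k, computable_treeOperator hgc hkc, ?_⟩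
  rintro _ K ⟨T, rfl, hT⟩
  set w : ℕ → ℕ × List ℕ := fun n =>
    ((levelApproximation g k n ((nextLevel (labelOf m T.name))^[k n] [([], [])])).headI,
      (levelApproximation g k n ((nextLevel (labelOf m T.name))^[k n] [([], [])])).tail) with hw
  refine ⟨fun n => Encodable.encode (w n), fun n => ⟨?_, fun j a ha => ?_⟩, w, fun n => rfl,
    fun n => dist_levelApproximation_lt hq1.le hq hg (hk n) hT⟩
  · obtain ⟨k₀, h⟩ := exists_nextLevelPrefix_iterate_eq (m := m) T.name (k n) [([], [])]
    refine ⟨k₀, ?_⟩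
    rw [treeOperator, h k₀ le_rfl]
    rfl
  · obtain ⟨L, hL, rfl⟩ := Option.map_eq_some_iff.1 ha
    rw [nextLevelPrefix_iterate_sound hL]

end Metric

/-! ### Both predicates hold everywhere -/

section Universal

variable {X : Type*} [MetricSpace X] {m : ℕ} {S : ExtendedIFS X (Fin m)} {u : ℕ → X}

/-- Cover `K` by finitely many balls of radius `2⁻⁽ⁿ⁺²⁾` and move their centres to basic points at
the same cost. -/
theorem cauchySet_basicSubset_eq_univ (hu : DenseRange u) :
    cauchySet (basicSubset u) = Set.univ := by
  refine Set.eq_univ_of_forall fun K n => ?_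
  have hpos := inv_two_pow_pos (n + 2)
  obtain ⟨t, htK, htf, hcov⟩ := K.isCompact.finite_cover_balls hpos
  choose a ha using fun x => hu.exists_dist_lt x hpos
  set l := (htf.toFinset.toList.map a) with hl
  have hmem : ∀ i, i ∈ l ↔ ∃ x ∈ t, a x = i := by simp [hl]
  have hne : l ≠ [] := by
    obtain ⟨x, hx⟩ := K.nonempty
    obtain ⟨y, hy, -⟩ := Set.mem_iUnion₂.1 (hcov hx)
    exact List.ne_nil_of_mem ((hmem _).2 ⟨y, hy, rfl⟩)
  refine ⟨(l.headI, l.tail), ?_⟩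
  change dist K (finiteSet u l) < _
  have e : (2 : ℝ)⁻¹ ^ (n + 2) = (2 : ℝ)⁻¹ ^ n / 4 := by ring
  rw [e] at ha hcov
  have := inv_two_pow_pos n
  refine (dist_le_of_forall_exists (r := (2 : ℝ)⁻¹ ^ n / 2) (by positivity) (fun x hx => ?_)
    fun y hy => ?_).trans_lt (by linarith)
  · obtain ⟨y, hy, hxy⟩ := Set.mem_iUnion₂.1 (hcov hx)
    rw [Metric.mem_ball] at hxy
    exact ⟨_, (mem_finiteSet hne).2 ⟨_, (hmem _).2 ⟨y, hy, rfl⟩, rfl⟩,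
      by linarith [dist_triangle x y (u (a y)), ha y]⟩
  · obtain ⟨i, hi, rfl⟩ := (mem_finiteSet hne).1 hy
    obtain ⟨x, hx, rfl⟩ := (hmem i).1 hi
    exact ⟨x, htK hx, by linarith [ha x]⟩

/-- Each digit maps the preimage of `K` onto the part of `K` in its range, and the ranges cover the
space; coinduction needs nothing else of the preimages but that they are compact and non-empty. -/
theorem coindSet_hyper_eq_univ (hS : S.IsDigitSpace) (hunary : ∀ d, S.ar d = 1) :
    S.hyper.coindSet = Set.univ := by
  classical
  have := hS.compact
  refine Set.eq_univ_of_univ_subset (OrderHom.le_gfp _ ?_)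
  intro K _
  have hpre : ∀ d, IsCompact (S.unary d ⁻¹' (K : Set X)) := fun d =>
    (K.isCompact.isClosed.preimage (S.continuous_unary d)).isCompact
  have hcov : ∀ x ∈ K, ∃ d y, S.unary d y = x := fun x _ => by
    obtain ⟨d, y, hy⟩ := hS.covering x
    exact ⟨d, _, (ExtendedIFS.map_eq_unary (hunary d) y).symm.trans hy⟩
  -- The value `K` is a filler for digits with empty preimage, which `E` leaves out.
  let L : Fin m → NonemptyCompacts X := fun d =>
    if h : (S.unary d ⁻¹' (K : Set X)).Nonempty then ⟨⟨_, hpre d⟩, h⟩ else K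
  have hL : ∀ d, (S.unary d ⁻¹' (K : Set X)).Nonempty →
      (L d : Set X) = S.unary d ⁻¹' (K : Set X) := fun d h => by
    simp only [L, dif_pos h]
    rfl
  let E := (List.finRange m).filter fun d => (S.unary d ⁻¹' (K : Set X)).Nonempty
  have hE : ∀ d, d ∈ E ↔ (S.unary d ⁻¹' (K : Set X)).Nonempty := by simp [E]
  have hne : E ≠ [] := by
    obtain ⟨x, hx⟩ := K.nonempty
    obtain ⟨d, y, rfl⟩ := hcov x hx
    exact List.ne_nil_of_mem ((hE d).2 ⟨y, hx⟩)
  refine ⟨⟨E, hne, (List.nodup_finRange m).filter _⟩, fun κ => L (E.get κ), ?_, fun _ => trivial⟩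
  apply NonemptyCompacts.ext
  change (K : Set X) = ⋃ κ : Fin E.length, S.unary (E.get κ) '' (L (E.get κ) : Set X)
  ext x
  simp only [Set.mem_iUnion]
  constructor
  · intro hx
    obtain ⟨d, y, rfl⟩ := hcov x hx
    have hd : (S.unary d ⁻¹' (K : Set X)).Nonempty := ⟨y, hx⟩
    obtain ⟨κ, rfl⟩ := List.get_of_mem ((hE d).2 hd)
    exact ⟨κ, y, by rw [hL _ hd]; exact hx, rfl⟩
  · rintro ⟨κ, y, hy, rfl⟩
    rw [hL _ ((hE _).1 (List.get_mem _ _))] at hy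
    exact hy

end Universal

end DigitSpace

theorem mainTheorem12 {X : Type*} [MetricSpace X] {m : ℕ}
    (S : DigitSpace.ExtendedIFS X (Fin m)) (u : ℕ → X)
    (hS : S.IsComputableDigitSpace u)
    (hcov : S.IsWellCovering)
    (hdec : S.IsDecidable u)
    (hchoice : S.HasApproximableChoice u)
    (hunary : ∀ d, S.ar d = 1) :
    DigitSpace.cauchySet (DigitSpace.basicSubset u) = S.hyper.coindSet ∧
    DigitSpace.ComputablyTranslates
      (DigitSpace.IsCauchyName (DigitSpace.basicSubset u)) S.hyper.IsTreeName ∧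
    DigitSpace.ComputablyTranslates
      S.hyper.IsTreeName (DigitSpace.IsCauchyName (DigitSpace.basicSubset u)) := by
  have := hS.digitSpace.compact
  obtain ⟨P, hc, hP⟩ := hS.exists_splitter hcov hdec hchoice hunary
  exact ⟨(DigitSpace.cauchySet_basicSubset_eq_univ hS.metric.dense).trans
    (DigitSpace.coindSet_hyper_eq_univ hS.digitSpace hunary).symm,
    DigitSpace.Splitter.computablyTranslates hc hP, hS.computablyTranslates_tree⟩
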